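/- Let $U$ be a finite set of $n$ items with weights $w:U\to[0,\infty)$ and total weight $W=\sum_{a\in U}w(a)>0$. An algorithm may draw independent proportional samples (each returns $(a,w(a))$ with probability $w(a)/W$), test two items for equality, and use independent private uniform random numbers in $[0,1]$; its cost is the number of proportional samples drawn. Write $B_b=\{a\in U: 2^b\le w(a)<2^{b+1}\}$ for $b\in\mathbb Z$. The algorithm $\mathrm{NoAdvicePropEstimator}(\varepsilon)$, which gets only $\varepsilon$ as input (it knows neither $n$ nor $w$), is the following. 1. Draw two samples $a_1,a_2$ and let $b=\max(\lfloor\log_2 w(a_1)\rfloor,\lfloor\log_2 w(a_2)\rfloor)$. 2. $\tilde n_b$ is the median of 15 independent runs of: draw uniform samples from $B_b$ until the first repeated item, and return $4s^2$, where $s$ is the number of distinct items seen. A proportional sample of $B_b$ is obtained by drawing until an item of $B_b$ appears; a uniform sample of $B_b$ is obtained by drawing proportional samples $a$ of $B_b$ and accepting $a$ with probability $2^b/w(a)$, until one is accepted. 3. $\hat W_b$ is the median of 15 independent runs of $\mathrm{PropEstimator}(\tilde n_b,\varepsilon/3)$ on proportional samples of $B_b$, where $\mathrm{PropEstimator}(\tilde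 n,\delta)$ takes $m=\lceil\sqrt{24\tilde n}/\delta\rceil+1$ samples and returns $\binom m2\big(\sum_{s\in S}\binom{c_s}{2}/w(s)\big)^{-1}$; here $S$ is the set of sampled items, $c_s$ is the multiplicity of $s$, and the value is $\infty$ if no item is repeated. 4. $\hat P_b$ is the median of 15 independent runs of: draw proportional samples from $U$ until $k=\lceil 12/(\varepsilon/3)^2\rceil$ of them lie in $B_b$, and return $k$ divided by the number of samples drawn. 5. Return $\hat W=\hat W_b/\hat P_b$. **Theorem.** There is an absolute constant $C>0$ such that for all $U$, $w$ as above with $W>0$ and all $0<\varepsilon<1$: (i) with probability at least $2/3$ the algorithm halts and its output satisfies $(1-\varepsilon)W\le\hat W\le(1+\varepsilon)W$; (ii) if $n\ge 2$, the expected number of proportional samples it draws (counted as $\infty$ on runs that do not halt) is at most $C\left(\dfrac{\sqrt n}{\varepsilon}+\dfrac{\log n}{\varepsilon^2}\right)$. -/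

import Mathlib

open MeasureTheory
open scoped NNReal ENNReal

noncomputable section

namespace PropSampling

/-! ### Randomized programs with proportional-sampling access -/

/-- The randomness available to a program: the answers to its successive proportional-sampling
queries (an item together with its weight) and its private uniform random numbers. -/
structure Tape (U : Type) where
  sample : ℕ → U × ℝ
  coin : ℕ → unitInterval

/-- A randomized program returning a value in `α`. Run on a tape it either diverges (`none`) or
returns a value, the number of proportional samples it has drawn, and the unread part of the tape.
All programs below are assembled from `pure`, `bind`, `draw`, `uniform` and `loop` only; they see
items through equality tests and see nothing of the universe besides the drawn samples. -/
def Prog (U α : Type) : Type := Tape U → Option (α × ℕ × Tape U)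

instance (U : Type) : Monad (Prog U) where
  pure a := fun t => some (a, 0, t)
  bind m f := fun t =>
    (m t).bind fun r => (f r.1 r.2.2).map fun q => (q.1, r.2.1 + q.2.1, q.2.2)

variable {U α σ : Type}

/-- Draw one proportional sample `(a, w a)`; this is the only operation of cost one. -/
def draw : Prog U (U × ℝ) := fun t =>
  some (t.sample 0, 1, ⟨fun i => t.sample (i + 1), t.coin⟩)

/-- Draw a real number uniformly from `[0, 1]`. -/
def uniform : Prog U ℝ := fun t =>
  some ((t.coin 0 : ℝ), 0, ⟨t.sample, fun i => t.coin (i + 1)⟩)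

/-- At most `k` rounds of a loop; a round returns a new loop state (`inl`) or the result (`inr`). -/
def loopFuel (body : σ → Prog U (σ ⊕ α)) : ℕ → σ → Prog U α
  | 0, _ => fun _ => none
  | k + 1, s => do
    match ← body s with
    | .inl s' => loopFuel body k s'
    | .inr a => pure a

open Classical in
/-- The unbounded loop: repeat `body` until it returns a result; diverge if it never does. -/
def loop (body : σ → Prog U (σ ⊕ α)) (s : σ) : Prog U α := fun t =>
  if h : ∃ k, (loopFuel body k s t).isSome then loopFuel body (Nat.find h) s t else none

/-- Run a program `k` times with fresh randomness and list the returned values. -/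
def replicate : ℕ → Prog U α → Prog U (List α)
  | 0, _ => pure []
  | k + 1, m => do
    let a ← m
    let l ← replicate k m
    pure (a :: l)

/-- The median of a list of odd length. -/
def median [LinearOrder α] [Inhabited α] (l : List α) : α :=
  (l.insertionSort (· ≤ ·)).getD (l.length / 2) default

/-- Probability amplification by the median trick. Fifteen runs raise a success probability of
`2 / 3` to at least `9 / 10`, since `P(Bin(15, 1/3) ≥ 8) < 1 / 10`. -/
def amplify [LinearOrder α] [Inhabited α] (m : Prog U α) : Prog U α := do
  let l ← replicate 15 m
  pure (median l)

/-! ### The algorithm -/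

/-- Sample proportionally until the weight lies in `[2^b, 2^(b+1))`. -/
def propBucketSampler (b : ℤ) : Prog U (U × ℝ) :=
  loop (fun _ : Unit => do
    let x ← draw
    if x.2 ∈ Set.Ico ((2 : ℝ) ^ b) ((2 : ℝ) ^ (b + 1)) then pure (.inr x) else pure (.inl ())) ()

/-- Rejection sampling: a sample of weight `v` from the bucket is rejected if a uniform number
exceeds `2^b / v`. -/
def unifBucketSampler (b : ℤ) : Prog U (U × ℝ) :=
  loop (fun _ : Unit => do
    let x ← propBucketSampler b
    let u ← uniform
    if u > (2 : ℝ) ^ b / x.2 then pure (.inl ()) else pure (.inr x)) ()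

/-- Sample until the first repeated item; return `4 s ^ 2`, where `s` is the number of distinct
items seen. -/
def setSizeEstimator [DecidableEq U] (sampler : Prog U (U × ℝ)) : Prog U ℕ :=
  loop (fun S : Finset U => do
    let x ← sampler
    if x.1 ∈ S then pure (.inr (4 * S.card ^ 2)) else pure (.inl (insert x.1 S))) ∅

/-- The estimate `(m choose 2) / ∑ₛ (cₛ choose 2) / w(s)` from a list of `m` samples, where `s`
ranges over the distinct sampled items and `cₛ` is the multiplicity of `s`; it is `∞` if no item
is repeated (and `m ≥ 2`). -/
def pairEstimate [DecidableEq U] (l : List (U × ℝ)) : ℝ≥0∞ :=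
  (l.length.choose 2 : ℝ≥0∞) *
    (∑ s ∈ l.toFinset,
      ((l.countP fun x => x.1 = s.1).choose 2 : ℝ≥0∞) / ENNReal.ofReal s.2)⁻¹

/-- The estimator with advice `n'`: take `m = ⌈√(24 n') / ε⌉ + 1` samples. -/
def propEstimator [DecidableEq U] (sampler : Prog U (U × ℝ)) (n' ε : ℝ) : Prog U ℝ≥0∞ := do
  let l ← replicate (⌈√(24 * n') / ε⌉₊ + 1) sampler
  pure (pairEstimate l)

/-- Estimate the success probability of a repeatable trial: repeat the trial until
`k = ⌈12 / ε ^ 2⌉` successes have occurred and return `k` divided by the number of trials.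
The loop state is (successes, trials). -/
def bernoulliEstimator (trial : Prog U Bool) (ε : ℝ) : Prog U ℝ :=
  loop (fun s : ℕ × ℕ => do
    let x ← trial
    let successes := if x then s.1 + 1 else s.1
    if successes = ⌈12 / ε ^ 2⌉₊ then pure (.inr ((successes : ℝ) / ((s.2 + 1 : ℕ) : ℝ)))
    else pure (.inl (successes, s.2 + 1))) (0, 0)

/-- One proportional sample, reporting whether it falls in the bucket `b`. -/
def bucketTrial (b : ℤ) : Prog U Bool := do
  let x ← draw
  pure (decide (x.2 ∈ Set.Ico ((2 : ℝ) ^ b) ((2 : ℝ) ^ (b + 1))))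

/-- The estimator of the total weight without advice. -/
def noAdvicePropEstimator [DecidableEq U] (ε : ℝ) : Prog U ℝ≥0∞ := do
  let x₁ ← draw
  let x₂ ← draw
  let b := max ⌊Real.logb 2 x₁.2⌋ ⌊Real.logb 2 x₂.2⌋
  let nb ← amplify (setSizeEstimator (unifBucketSampler b))
  let Wb ← amplify (propEstimator (propBucketSampler b) nb (ε / 3))
  let Pb ← amplify (bernoulliEstimator (bucketTrial b) (ε / 3))
  pure (Wb / ENNReal.ofReal Pb)

/-! ### Executing a program on a weighted universe -/

/-- The tape on which the drawn items are `ω.1 0, ω.1 1, …`, each reported with its weight. -/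
def tapeOf (w : U → ℝ≥0) (ω : (ℕ → U) × (ℕ → unitInterval)) : Tape U :=
  ⟨fun i => (ω.1 i, (w (ω.1 i) : ℝ)), ω.2⟩

/-- The proportional distribution on `U`: item `a` has probability `w a / ∑ x, w x`. -/
def propPMF [Fintype U] (w : U → ℝ≥0) (hw : 0 < ∑ a, w a) : PMF U :=
  PMF.ofFintype (fun a => ((w a / ∑ x, w x : ℝ≥0) : ℝ≥0∞)) (by
    rw [← ENNReal.ofNNReal_finsetSum, ← Finset.sum_div, div_self hw.ne', ENNReal.coe_one])

/-- The law of the randomness: independent proportional samples and, independently of them,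
independent uniform numbers in `[0, 1]`. -/
def randomness [Fintype U] [MeasurableSpace U] (w : U → ℝ≥0) (hw : 0 < ∑ a, w a) :
    Measure ((ℕ → U) × (ℕ → unitInterval)) :=
  (Measure.infinitePi fun _ : ℕ => (propPMF w hw).toMeasure).prod
    (Measure.infinitePi fun _ : ℕ => (volume : Measure unitInterval))

/-- The number of proportional samples drawn by a run, `∞` if the run diverges. -/
def sampleCount (m : Prog U α) (t : Tape U) : ℝ≥0∞ :=
  match m t with
  | none => ⊤
  | some r => (r.2.1 : ℝ≥0∞)

/-- The run halts and its output is a `(1 ± ε)`-approximation of `W`. -/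
def Approximates (m : Prog U ℝ≥0∞) (t : Tape U) (ε W : ℝ) : Prop :=
  ∃ r, m t = some r ∧ ENNReal.ofReal ((1 - ε) * W) ≤ r.1 ∧ r.1 ≤ ENNReal.ofReal ((1 + ε) * W)

end PropSampling

end

/-!
Let `b` be the larger of the levels `⌊log₂ w⌋` of the two initial samples, `n_b` the size and `W_b`
the weight of its bucket, and `P_b = W_b / W`. The weights in a bucket agree up to a factor `2`, so
rejection sampling makes its uniform samples cheap and a birthday argument finds `n_b` up to a
constant factor from `O(√n_b)` of them. Counting repetitions among `O(√n_b / ε)` proportional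
samples gives `W_b`, and waiting for `O(1 / ε²)` hits of the bucket gives `P_b`. Each of the three
estimators succeeds with probability at least `2 / 3`, which the median of fifteen runs raises to
`9 / 10`.

A proportional sample of the bucket costs `1 / P_b` samples of the universe, so the expected cost
given `b` is `O((√n_b / ε + 1 / ε²) / P_b)`. Let `L_b` be the probability that a sample has level at
most `b`. As `b` is the maximum of two levels, it is chosen with probability at most `2 P_b L_b`,
and `P_b` cancels: the expected cost is `O(∑_b L_b (√n_b / ε + 1 / ε²))`. Below the level of the
mean weight `L_b` decays geometrically; above it `n_b ≤ W / 2^b` does, and only `O(log n)` levels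
there are at most `log₂ W`.
-/

noncomputable section

namespace PropSampling

variable {U α β σ : Type}

/-! ### Expected values of programs -/

/-- The value of a functional of output, cost and unread tape at the outcome of a run, taken to be
`0` at a diverging run. -/
def onHalt (H : α → ℕ → Tape U → ℝ≥0∞) (o : Option (α × ℕ × Tape U)) : ℝ≥0∞ :=
  o.elim 0 fun r => H r.1 r.2.1 r.2.2

@[simp] lemma onHalt_none (H : α → ℕ → Tape U → ℝ≥0∞) : onHalt H none = 0 := rfl

@[simp] lemma onHalt_some (H : α → ℕ → Tape U → ℝ≥0∞) (r : α × ℕ × Tape U) :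
    onHalt H (some r) = H r.1 r.2.1 r.2.2 := rfl

lemma onHalt_pure (H : α → ℕ → Tape U → ℝ≥0∞) (a : α) (t : Tape U) :
    onHalt H ((pure a : Prog U α) t) = H a 0 t := rfl

lemma bind_apply (m : Prog U α) (f : α → Prog U β) (t : Tape U) :
    (m >>= f) t = (m t).bind fun r => (f r.1 r.2.2).map fun q => (q.1, r.2.1 + q.2.1, q.2.2) :=
  rfl

lemma onHalt_bind (H : β → ℕ → Tape U → ℝ≥0∞) (m : Prog U α) (f : α → Prog U β) (t : Tape U) :
    onHalt H ((m >>= f) t) =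
      onHalt (fun a c t' => onHalt (fun b d => H b (c + d)) (f a t')) (m t) := by
  rw [bind_apply]
  rcases m t with _ | ⟨a, c, t'⟩
  · rfl
  · simp only [Option.bind_some, onHalt_some]
    rcases f a t' with _ | ⟨b, d, t''⟩ <;> rfl

lemma onHalt_mono {H K : α → ℕ → Tape U → ℝ≥0∞} (h : ∀ a c t, H a c t ≤ K a c t)
    (o : Option (α × ℕ × Tape U)) : onHalt H o ≤ onHalt K o := by
  rcases o with _ | r
  exacts [le_rfl, h _ _ _]

section TapeLaw

variable {mT : MeasurableSpace (Tape U)}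

/-- The expected value, under the law `P` of the tape, of a functional of the output and the cost
of a run; diverging runs contribute `0`. -/
def expect (P : Measure (Tape U)) (m : Prog U α) (G : α → ℕ → ℝ≥0∞) : ℝ≥0∞ :=
  ∫⁻ t, onHalt (fun a c _ => G a c) (m t) ∂P

/-- The expected value of a function of the output; diverging runs contribute `0`. -/
def mean (P : Measure (Tape U)) (m : Prog U α) (g : α → ℝ≥0∞) : ℝ≥0∞ :=
  expect P m fun a _ => g a

/-- The probability that a run terminates with an output in `s`. -/
def prob (P : Measure (Tape U)) (m : Prog U α) (s : Set α) : ℝ≥0∞ :=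
  mean P m (s.indicator 1)

/-- The expected number of samples drawn by the terminating runs. -/
def cost (P : Measure (Tape U)) (m : Prog U α) : ℝ≥0∞ :=
  expect P m fun _ c => (c : ℝ≥0∞)

/-- The tape left over by a terminating run is distributed as a new tape, independently of the
output and the cost of the run. Since the outputs carry no σ-algebra, this is phrased through
functionals that are measurable in the tape for every fixed output and cost; it therefore
restricts to programs with essentially countably many outputs. -/
structure Fresh (P : Measure (Tape U)) (m : Prog U α) : Prop where
  measurable : ∀ H : α → ℕ → Tape U → ℝ≥0∞, (∀ a c, Measurable (H a c)) →
    Measurable fun t => onHalt H (m t)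
  lintegral : ∀ H : α → ℕ → Tape U → ℝ≥0∞, (∀ a c, Measurable (H a c)) →
    ∫⁻ t, onHalt H (m t) ∂P = expect P m fun a c => ∫⁻ t, H a c t ∂P

/-- A program that leaves a fresh tape and terminates almost surely. -/
structure Proper (P : Measure (Tape U)) (m : Prog U α) : Prop extends Fresh P m where
  mean_one : mean P m (fun _ => 1) = 1

variable {P : Measure (Tape U)}

lemma expect_mono {m : Prog U α} {G K : α → ℕ → ℝ≥0∞} (h : ∀ a c, G a c ≤ K a c) :
    expect P m G ≤ expect P m K :=
  lintegral_mono fun _ => onHalt_mono (fun a c _ => h a c) _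

lemma mean_mono {m : Prog U α} {g h : α → ℝ≥0∞} (hgh : ∀ a, g a ≤ h a) :
    mean P m g ≤ mean P m h :=
  expect_mono fun a _ => hgh a

lemma Fresh.measurable_const {m : Prog U α} (hm : Fresh P m) (G : α → ℕ → ℝ≥0∞) :
    Measurable fun t => onHalt (fun a c _ => G a c) (m t) :=
  hm.measurable _ fun _ _ => _root_.measurable_const

lemma Fresh.expect_add {m : Prog U α} (hm : Fresh P m) (G K : α → ℕ → ℝ≥0∞) :
    expect P m (fun a c => G a c + K a c) = expect P m G + expect P m K := by
  unfold expect
  rw [← lintegral_add_left (hm.measurable_const G)]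
  refine lintegral_congr fun t => ?_
  rcases m t with _ | r <;> simp

lemma Fresh.expect_mul_const {m : Prog U α} (hm : Fresh P m) (G : α → ℕ → ℝ≥0∞) (r : ℝ≥0∞) :
    expect P m (fun a c => G a c * r) = expect P m G * r := by
  unfold expect
  rw [← lintegral_mul_const _ (hm.measurable_const G)]
  refine lintegral_congr fun t => ?_
  rcases m t with _ | _ <;> simp

lemma Fresh.mean_add {m : Prog U α} (hm : Fresh P m) (g h : α → ℝ≥0∞) :
    mean P m (fun a => g a + h a) = mean P m g + mean P m h :=
  hm.expect_add _ _

lemma Fresh.mean_mul_const {m : Prog U α} (hm : Fresh P m) (g : α → ℝ≥0∞) (r : ℝ≥0∞) :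
    mean P m (fun a => g a * r) = mean P m g * r :=
  hm.expect_mul_const _ _

lemma Proper.mean_const {m : Prog U α} (hm : Proper P m) (r : ℝ≥0∞) :
    mean P m (fun _ => r) = r := by
  simpa [hm.mean_one] using hm.mean_mul_const (fun _ => 1) r

/-! ### Sequential composition -/

lemma Fresh.expect_bind {m : Prog U α} {f : α → Prog U β} (hm : Fresh P m)
    (hf : ∀ a, Fresh P (f a)) (G : β → ℕ → ℝ≥0∞) :
    expect P (m >>= f) G = expect P m fun a c => expect P (f a) fun b d => G b (c + d) := by
  unfold expect
  simp only [onHalt_bind]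
  exact hm.lintegral (fun a c t' => onHalt (fun b d _ => G b (c + d)) (f a t'))
    fun a c => (hf a).measurable_const _

lemma Fresh.bind {m : Prog U α} {f : α → Prog U β} (hm : Fresh P m)
    (hf : ∀ a, Fresh P (f a)) : Fresh P (m >>= f) where
  measurable H hH := by
    simp only [onHalt_bind]
    exact hm.measurable _ fun a c => (hf a).measurable _ fun b d => hH b (c + d)
  lintegral H hH := by
    simp only [onHalt_bind]
    rw [hm.lintegral _ fun a c => (hf a).measurable _ fun b d => hH b (c + d),
      hm.expect_bind hf]
    congr! with a c
    exact (hf a).lintegral _ fun b d => hH b (c + d)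

lemma Fresh.mean_bind {m : Prog U α} {f : α → Prog U β} (hm : Fresh P m)
    (hf : ∀ a, Fresh P (f a)) (g : β → ℝ≥0∞) :
    mean P (m >>= f) g = mean P m fun a => mean P (f a) g :=
  hm.expect_bind hf _

lemma Proper.bind {m : Prog U α} {f : α → Prog U β} (hm : Proper P m)
    (hf : ∀ a, Proper P (f a)) : Proper P (m >>= f) where
  toFresh := hm.toFresh.bind fun a => (hf a).toFresh
  mean_one := by
    rw [hm.mean_bind fun a => (hf a).toFresh]
    simp only [(hf _).mean_one, hm.mean_one]

variable [IsProbabilityMeasure P]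

lemma mean_one_le (m : Prog U α) : mean P m (fun _ => 1) ≤ 1 :=
  calc mean P m (fun _ => 1) ≤ ∫⁻ _, 1 ∂P :=
        lintegral_mono fun t => by rcases m t with _ | _ <;> simp
    _ = 1 := by simp

lemma prob_le_one (m : Prog U α) (s : Set α) : prob P m s ≤ 1 :=
  (mean_mono fun _ => Set.indicator_le_self' (fun _ _ => zero_le) _).trans (mean_one_le m)

lemma Fresh.mean_const_le {m : Prog U α} (hm : Fresh P m) (r : ℝ≥0∞) :
    mean P m (fun _ => r) ≤ r := by
  have h := hm.mean_mul_const (fun _ => 1) r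
  simp only [one_mul] at h
  exact h.trans_le (mul_le_of_le_one_left zero_le (mean_one_le m))

lemma expect_pure (a : α) (G : α → ℕ → ℝ≥0∞) : expect P (pure a) G = G a 0 := by
  simp [expect, onHalt_pure]

lemma mean_pure (a : α) (g : α → ℝ≥0∞) : mean P (pure a) g = g a := expect_pure _ _

lemma cost_pure (a : α) : cost P (pure a) = 0 := by simp [cost, expect_pure]

lemma Fresh.pure (a : α) : Fresh P (pure a) where
  measurable H hH := hH a 0
  lintegral H _ := by simp only [onHalt_pure, expect_pure]

lemma Proper.pure (a : α) : Proper P (pure a) := ⟨Fresh.pure a, mean_pure a _⟩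

lemma Fresh.cost_bind_le {m : Prog U α} {f : α → Prog U β} (hm : Fresh P m)
    (hf : ∀ a, Fresh P (f a)) :
    cost P (m >>= f) ≤ cost P m + mean P m fun a => cost P (f a) := by
  unfold cost mean
  rw [hm.expect_bind hf, ← hm.expect_add]
  refine expect_mono fun a c => ?_
  simp only [Nat.cast_add]
  rw [(hf a).expect_add]
  gcongr
  exact (hf a).mean_const_le _

lemma Fresh.mean_bind_pure {m : Prog U α} (hm : Fresh P m) (f : α → β) (g : β → ℝ≥0∞) :
    mean P (m >>= fun a => Pure.pure (f a)) g = mean P m fun a => g (f a) := by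
  simp only [hm.mean_bind fun a => Fresh.pure (f a), mean_pure]

lemma Fresh.cost_bind_pure_le {m : Prog U α} (hm : Fresh P m) (f : α → β) :
    cost P (m >>= fun a => Pure.pure (f a)) ≤ cost P m := by
  refine (hm.cost_bind_le fun a => Fresh.pure (f a)).trans ?_
  simpa only [cost_pure] using add_le_of_nonpos_right (hm.mean_const_le 0)

end TapeLaw

/-! ### Loops -/

/-- The continuation of a loop after one round, `k` being the behaviour in later rounds. -/
def afterRound (k : σ → Prog U α) : σ ⊕ α → Prog U α :=
  Sum.elim k pure

lemma loopFuel_succ (body : σ → Prog U (σ ⊕ α)) (k : ℕ) (s : σ) :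
    loopFuel body (k + 1) s = body s >>= afterRound (loopFuel body k) := by
  change (body s >>= _) = _
  congr! 2 with x
  rcases x with s' | a <;> rfl

lemma loopFuel_succ_eq_some {body : σ → Prog U (σ ⊕ α)} {k : ℕ} {s : σ} {t : Tape U}
    {r : α × ℕ × Tape U} (h : loopFuel body k s t = some r) :
    loopFuel body (k + 1) s t = some r := by
  induction k generalizing s t r with
  | zero => simp [loopFuel] at h
  | succ k ih =>
    rw [loopFuel_succ, bind_apply, Option.bind_eq_some_iff] at h ⊢
    obtain ⟨⟨x, c, t'⟩, hx, h⟩ := h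
    refine ⟨_, hx, ?_⟩
    rcases x with s' | a
    · obtain ⟨q, hq, rfl⟩ := Option.map_eq_some_iff.1 h
      exact Option.map_eq_some_iff.2 ⟨q, ih hq, rfl⟩
    · exact h

lemma loopFuel_eq_some_mono {body : σ → Prog U (σ ⊕ α)} {k l : ℕ} (hkl : k ≤ l) {s : σ}
    {t : Tape U} {r : α × ℕ × Tape U} (h : loopFuel body k s t = some r) :
    loopFuel body l s t = some r := by
  induction l, hkl using Nat.le_induction with
  | base => exact h
  | succ l _ ih => exact loopFuel_succ_eq_some ih

lemma monotone_onHalt_loopFuel (H : α → ℕ → Tape U → ℝ≥0∞) (body : σ → Prog U (σ ⊕ α)) (s : σ)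
    (t : Tape U) : Monotone fun k => onHalt H (loopFuel body k s t) := by
  intro k l hkl
  rcases h : loopFuel body k s t with _ | r
  · simp [h]
  · simp [h, loopFuel_eq_some_mono hkl h]

lemma loop_eq_some {body : σ → Prog U (σ ⊕ α)} {k : ℕ} {s : σ} {t : Tape U}
    {r : α × ℕ × Tape U} (h : loopFuel body k s t = some r) : loop body s t = some r := by
  classical
  have hk : (loopFuel body k s t).isSome := Option.isSome_of_eq_some h
  have halts : ∃ k, (loopFuel body k s t).isSome := ⟨k, hk⟩
  obtain ⟨r', hr'⟩ := Option.isSome_iff_exists.1 (Nat.find_spec halts)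
  have hl : loop body s t = some r' := (dif_pos halts).trans hr'
  rw [hl, ← h, ← loopFuel_eq_some_mono (Nat.find_min' halts hk) hr']

lemma onHalt_loop (H : α → ℕ → Tape U → ℝ≥0∞) (body : σ → Prog U (σ ⊕ α)) (s : σ) (t : Tape U) :
    onHalt H (loop body s t) = ⨆ k, onHalt H (loopFuel body k s t) := by
  apply le_antisymm
  · by_cases h : ∃ k, (loopFuel body k s t).isSome
    · rw [loop, dif_pos h]
      exact le_iSup (fun k => onHalt H (loopFuel body k s t)) _
    · rw [loop, dif_neg h]
      exact zero_le
  · refine iSup_le fun k => ?_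
    rcases hk : loopFuel body k s t with _ | r
    · exact zero_le
    · rw [loop_eq_some hk]

section TapeLaw

variable {mT : MeasurableSpace (Tape U)} {P : Measure (Tape U)} [IsProbabilityMeasure P]
  {body : σ → Prog U (σ ⊕ α)}

lemma Fresh.loopFuel (hb : ∀ s, Fresh P (body s)) (k : ℕ) (s : σ) :
    Fresh P (loopFuel body k s) := by
  induction k generalizing s with
  | zero =>
    exact ⟨fun H _ => _root_.measurable_const,
      fun H _ => by simp [PropSampling.loopFuel, expect]⟩
  | succ k ih =>
    rw [loopFuel_succ]
    exact (hb s).bind (Sum.rec ih Fresh.pure)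

lemma expect_loop (hb : ∀ s, Fresh P (body s)) (s : σ) (G : α → ℕ → ℝ≥0∞) :
    expect P (loop body s) G = ⨆ k, expect P (loopFuel body k s) G := by
  unfold expect
  simp only [onHalt_loop]
  exact lintegral_iSup (fun k => (Fresh.loopFuel hb k s).measurable_const G)
    fun k l hkl t => monotone_onHalt_loopFuel _ body s t hkl

lemma Fresh.loop (hb : ∀ s, Fresh P (body s)) (s : σ) : Fresh P (loop body s) where
  measurable H hH := by
    simp only [onHalt_loop]
    exact Measurable.iSup fun k => (Fresh.loopFuel hb k s).measurable H hH
  lintegral H hH := by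
    simp only [onHalt_loop]
    rw [lintegral_iSup (fun k => (Fresh.loopFuel hb k s).measurable H hH)
      fun k l hkl t => monotone_onHalt_loopFuel _ body s t hkl, expect_loop hb]
    exact iSup_congr fun k => (Fresh.loopFuel hb k s).lintegral H hH

lemma expect_loopFuel_succ (hb : ∀ s, Fresh P (body s)) (k : ℕ) (s : σ) (G : α → ℕ → ℝ≥0∞) :
    expect P (loopFuel body (k + 1) s) G = expect P (body s) fun x c =>
      Sum.elim (fun s' => expect P (loopFuel body k s') fun b d => G b (c + d))
        (fun a => G a c) x := by
  rw [loopFuel_succ, (hb s).expect_bind (Sum.rec (Fresh.loopFuel hb k) Fresh.pure)]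
  congr! with x c
  rcases x with s' | a
  · rfl
  · exact expect_pure _ _

lemma mean_loopFuel_succ (hb : ∀ s, Fresh P (body s)) (k : ℕ) (s : σ) (g : α → ℝ≥0∞) :
    mean P (loopFuel body (k + 1) s) g =
      mean P (body s) (Sum.elim (fun s' => mean P (loopFuel body k s') g) g) := by
  unfold mean
  rw [expect_loopFuel_succ hb]

/-- A potential that pays, in expectation, for the charge of every round and for the final reward
bounds the total: the sum is a supermartingale along the rounds of the loop. -/
lemma expect_loop_le (hb : ∀ s, Fresh P (body s)) {r : ℝ≥0∞} {g : α → ℝ≥0∞} {Φ : σ → ℝ≥0∞}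
    (hΦ : ∀ s, expect P (body s) (fun x c => c * r + Sum.elim Φ g x) ≤ Φ s) (s : σ) :
    expect P (loop body s) (fun a c => c * r + g a) ≤ Φ s := by
  rw [expect_loop hb]
  refine iSup_le fun k => ?_
  induction k generalizing s with
  | zero => simp [PropSampling.loopFuel, expect]
  | succ k ih =>
    rw [expect_loopFuel_succ hb]
    refine (expect_mono ?_).trans (hΦ s)
    rintro (s' | a) c
    · simp only [Sum.elim_inl, Nat.cast_add, add_mul, add_assoc]
      rw [(Fresh.loopFuel hb k s').expect_add]
      exact add_le_add ((Fresh.loopFuel hb k s').mean_const_le _) (ih s')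
    · exact le_rfl

lemma mean_loop_le (hb : ∀ s, Fresh P (body s)) {g : α → ℝ≥0∞} {Φ : σ → ℝ≥0∞}
    (hΦ : ∀ s, mean P (body s) (Sum.elim Φ g) ≤ Φ s) (s : σ) :
    mean P (loop body s) g ≤ Φ s := by
  simpa [mean] using expect_loop_le hb (r := 0) (g := g) (Φ := Φ) (by simpa [mean] using hΦ) s

lemma cost_loop_le (hb : ∀ s, Fresh P (body s)) {Φ : σ → ℝ≥0∞}
    (hΦ : ∀ s, cost P (body s) + mean P (body s) (Sum.elim Φ fun _ => 0) ≤ Φ s) (s : σ) :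
    cost P (loop body s) ≤ Φ s := by
  have h := expect_loop_le hb (r := 1) (g := fun _ => 0) (Φ := Φ) (fun s => by
    simpa only [mul_one, (hb s).expect_add, cost, mean] using hΦ s) s
  simpa only [mul_one, add_zero, cost] using h

lemma natCast_le_add_mul_mean_loopFuel (hb : ∀ s, Proper P (body s)) {Φ : σ → ℝ≥0∞}
    (hΦ : ∀ s, 1 + mean P (body s) (Sum.elim Φ fun _ => 0) ≤ Φ s) (k : ℕ) (s : σ) :
    (k : ℝ≥0∞) ≤ Φ s + k * mean P (loopFuel body k s) fun _ => 1 := by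
  have hf := fun s => (hb s).toFresh
  induction k generalizing s with
  | zero => simp
  | succ k ih =>
    calc ((k + 1 : ℕ) : ℝ≥0∞) = 1 + mean P (body s) (fun _ => (k : ℝ≥0∞)) := by
          rw [(hb s).mean_const, Nat.cast_add_one, add_comm]
      _ ≤ 1 + mean P (body s) (fun x => Sum.elim Φ (fun _ => 0) x +
            Sum.elim (fun s' => mean P (loopFuel body k s') fun _ => 1) (fun _ => 1) x * k) := by
          gcongr
          refine mean_mono (Sum.rec (fun s' => ?_) fun _ => by simp)
          simpa only [Sum.elim_inl, mul_comm] using ih s'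
      _ = 1 + mean P (body s) (Sum.elim Φ fun _ => 0) +
            k * mean P (loopFuel body (k + 1) s) fun _ => 1 := by
          rw [(hf s).mean_add, (hf s).mean_mul_const, mean_loopFuel_succ hf, add_assoc, mul_comm]
      _ ≤ Φ s + ((k + 1 : ℕ) : ℝ≥0∞) * mean P (loopFuel body (k + 1) s) fun _ => 1 := by
          gcongr
          · exact hΦ s
          · exact k.le_succ

/-- A finite potential that decreases in expectation by one in every round forces termination. -/
lemma Proper.loop (hb : ∀ s, Proper P (body s)) {Φ : σ → ℝ≥0∞}
    (hΦ : ∀ s, 1 + mean P (body s) (Sum.elim Φ fun _ => 0) ≤ Φ s) {s : σ} (hs : Φ s ≠ ⊤) :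
    Proper P (loop body s) where
  toFresh := Fresh.loop (fun s => (hb s).toFresh) s
  mean_one := by
    set q := mean P (PropSampling.loop body s) fun _ => 1
    have hk (k : ℕ) : (k : ℝ≥0∞) * (1 - q) ≤ Φ s := by
      rw [ENNReal.mul_sub fun _ _ => ENNReal.natCast_ne_top k, mul_one, tsub_le_iff_right]
      refine (natCast_le_add_mul_mean_loopFuel hb hΦ k s).trans ?_
      gcongr
      exact (le_iSup (fun k => expect P (PropSampling.loopFuel body k s) fun _ _ => 1) k).trans_eq
        (expect_loop (fun s => (hb s).toFresh) s _).symm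
    refine le_antisymm (mean_one_le _) (tsub_eq_zero_iff_le.1 ?_)
    by_contra hne
    obtain ⟨k, hlt⟩ := ENNReal.exists_nat_mul_gt hne hs
    exact hlt.not_ge (hk k)

end TapeLaw

/-! ### Independent repetitions -/

lemma replicate_succ (k : ℕ) (m : Prog U α) :
    replicate (k + 1) m = m >>= fun a => replicate k m >>= fun l => pure (a :: l) := rfl

section TapeLaw

variable {mT : MeasurableSpace (Tape U)} {P : Measure (Tape U)} [IsProbabilityMeasure P]
  {m : Prog U α}

lemma Fresh.replicate (hm : Fresh P m) (k : ℕ) : Fresh P (replicate k m) := by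
  induction k with
  | zero => exact Fresh.pure _
  | succ k ih => exact hm.bind fun _ => ih.bind fun _ => Fresh.pure _

lemma Proper.replicate (hm : Proper P m) (k : ℕ) : Proper P (replicate k m) := by
  induction k with
  | zero => exact Proper.pure _
  | succ k ih => exact hm.bind fun _ => ih.bind fun _ => Proper.pure _

lemma Fresh.mean_replicate_succ (hm : Fresh P m) (k : ℕ) (g : List α → ℝ≥0∞) :
    mean P (PropSampling.replicate (k + 1) m) g =
      mean P m fun a => mean P (PropSampling.replicate k m) fun l => g (a :: l) := by
  rw [replicate_succ, hm.mean_bind fun a => (hm.replicate k).bind fun _ => Fresh.pure _]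
  simp only [(hm.replicate k).mean_bind_pure]

lemma Fresh.cost_replicate_le (hm : Fresh P m) (k : ℕ) :
    cost P (PropSampling.replicate k m) ≤ k * cost P m := by
  induction k with
  | zero => simp [PropSampling.replicate, cost_pure]
  | succ k ih =>
    calc cost P (PropSampling.replicate (k + 1) m)
        ≤ cost P m + mean P m fun _ => k * cost P m :=
          (hm.cost_bind_le fun a => (hm.replicate k).bind fun _ => Fresh.pure _).trans <| by
            gcongr
            exact mean_mono fun a => ((hm.replicate k).cost_bind_pure_le _).trans ih
      _ ≤ cost P m + k * cost P m := by gcongr; exact hm.mean_const_le _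
      _ = (k + 1 : ℕ) * cost P m := by push_cast; ring

lemma Fresh.mean_replicate_sum_le (hm : Fresh P m) (k : ℕ) (g : α → ℝ≥0∞) :
    mean P (PropSampling.replicate k m) (fun l => (l.map g).sum) ≤ k * mean P m g := by
  induction k with
  | zero => simp [PropSampling.replicate, mean_pure]
  | succ k ih =>
    calc mean P (PropSampling.replicate (k + 1) m) (fun l => (l.map g).sum)
        ≤ mean P m fun a => g a + k * mean P m g := by
          rw [hm.mean_replicate_succ]
          refine mean_mono fun a => ?_
          simp only [List.map_cons, List.sum_cons, (hm.replicate k).mean_add]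
          exact add_le_add ((hm.replicate k).mean_const_le _) ih
      _ ≤ mean P m g + k * mean P m g := by
          rw [hm.mean_add]
          gcongr
          exact hm.mean_const_le _
      _ = (k + 1 : ℕ) * mean P m g := by push_cast; ring

lemma Fresh.mean_replicate_mono (hm : Fresh P m) (k : ℕ) {g h : List α → ℝ≥0∞}
    (hgh : ∀ l, l.length = k → g l ≤ h l) :
    mean P (PropSampling.replicate k m) g ≤ mean P (PropSampling.replicate k m) h := by
  induction k generalizing g h with
  | zero => simpa [PropSampling.replicate, mean_pure] using hgh [] rfl
  | succ k ih =>
    simp only [hm.mean_replicate_succ]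
    exact mean_mono fun a => ih fun l hl => hgh _ (congrArg (· + 1) hl)

end TapeLaw

/-! ### Probability amplification -/

section Median

variable [LinearOrder α]

lemma forall_take_notMem_or_forall_drop_notMem {l : List α} (hl : l.SortedLE) {s : Set α}
    (hs : s.OrdConnected) {n : ℕ} (hn : n < l.length) (h : l[n] ∉ s) :
    (∀ a ∈ l.take (n + 1), a ∉ s) ∨ ∀ a ∈ l.drop n, a ∉ s := by
  by_contra! ⟨⟨a, ha, has⟩, b, hb, hbs⟩
  obtain ⟨i, hi, rfl⟩ := List.mem_take_iff_getElem.1 ha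
  obtain ⟨j, hj, rfl⟩ := List.mem_drop_iff_getElem.1 hb
  exact h (hs.out has hbs ⟨hl.getElem_le_getElem_of_le (by omega),
    hl.getElem_le_getElem_of_le (by omega)⟩)

lemma succ_le_countP_of_getElem_notMem {s : Set α} [DecidablePred (· ∈ s)] (hs : s.OrdConnected)
    {l : List α} (hl : l.SortedLE) {n : ℕ} (hn : l.length = 2 * n + 1) (h : l[n] ∉ s) :
    n + 1 ≤ l.countP (· ∉ s) := by
  rcases forall_take_notMem_or_forall_drop_notMem hl hs (by omega) h with h | h
  · calc n + 1 = (l.take (n + 1)).length := by rw [List.length_take]; omega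
      _ = (l.take (n + 1)).countP (· ∉ s) := (List.countP_eq_length.2 (by simpa using h)).symm
      _ ≤ l.countP (· ∉ s) := (List.take_sublist _ _).countP_le
  · calc n + 1 = (l.drop n).length := by rw [List.length_drop]; omega
      _ = (l.drop n).countP (· ∉ s) := (List.countP_eq_length.2 (by simpa using h)).symm
      _ ≤ l.countP (· ∉ s) := (List.drop_sublist _ _).countP_le

variable [Inhabited α]

lemma median_eq_getElem {l : List α} (hl : l ≠ []) :
    median l = (l.insertionSort (· ≤ ·))[l.length / 2]'(by
      rw [List.length_insertionSort]
      exact Nat.div_lt_self (List.length_pos_iff.2 hl) one_lt_two) :=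
  List.getD_eq_getElem _ _ _

lemma median_mem {l : List α} (hl : l ≠ []) : median l ∈ l := by
  rw [median_eq_getElem hl]
  exact (List.mem_insertionSort (· ≤ ·)).1 (List.getElem_mem _)

lemma succ_le_countP_of_median_notMem {s : Set α} [DecidablePred (· ∈ s)] (hs : s.OrdConnected)
    {l : List α} {n : ℕ} (hn : l.length = 2 * n + 1) (h : median l ∉ s) :
    n + 1 ≤ l.countP (· ∉ s) := by
  rw [← (List.perm_insertionSort (· ≤ ·) l).countP_eq]
  have hhalf : l.length / 2 = n := by omega
  rw [median_eq_getElem (by rintro rfl; simp at hn)] at h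
  simp only [hhalf] at h
  exact succ_le_countP_of_getElem_notMem hs (List.pairwise_insertionSort _ _).sortedLE
    (by rw [List.length_insertionSort, hn]) h

end Median

/-- `3 ^ n` times the probability of at least `k` successes in `n` independent trials of success
probability `1 / 3`. -/
def binomialTail : ℕ → ℕ → ℕ
  | n, 0 => 3 ^ n
  | 0, _ + 1 => 0
  | n + 1, k + 1 => binomialTail n k + 2 * binomialTail n (k + 1)

lemma binomialTail_zero (n : ℕ) : binomialTail n 0 = 3 ^ n := by
  cases n <;> rfl

lemma binomialTail_succ_le (n k : ℕ) : binomialTail n (k + 1) ≤ binomialTail n k := by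
  induction n generalizing k with
  | zero => exact Nat.zero_le _
  | succ n ih =>
    have h := ih k
    rcases k with _ | k
    · rw [binomialTail_zero] at h
      simp only [binomialTail, binomialTail_zero, pow_succ]
      omega
    · have h' := ih k
      simp only [binomialTail]
      omega

section TapeLaw

variable {mT : MeasurableSpace (Tape U)} {P : Measure (Tape U)} [IsProbabilityMeasure P]
  {m : Prog U α}

/-- A trial put in front shifts the count by one with probability at most `1 / 3`; since the tail
decreases in `k`, probability exactly `1 / 3` is the worst case. -/
lemma Fresh.prob_replicate_countP_mul_le (hm : Fresh P m) {p : α → Prop} [DecidablePred p]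
    (h : prob P m {a | p a} ≤ 1 / 3) (n k : ℕ) :
    prob P (PropSampling.replicate n m) {l | k ≤ l.countP p} * 3 ^ n ≤ binomialTail n k := by
  induction n generalizing k with
  | zero => cases k <;> simp [PropSampling.replicate, prob, mean_pure, binomialTail]
  | succ n ih =>
    rcases k with _ | k
    · rw [binomialTail_zero, Nat.cast_pow]
      exact mul_le_of_le_one_left zero_le (prob_le_one _ _)
    · obtain ⟨D, hD⟩ := Nat.exists_eq_add_of_le (binomialTail_succ_le n k)
      have hstep (a : α) : prob P (PropSampling.replicate n m) {l | k + 1 ≤ (a :: l).countP p} *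
          3 ^ n ≤ {a | p a}.indicator 1 a * D + binomialTail n (k + 1) := by
        by_cases ha : p a
        · have hk := ih k
          rw [hD, Nat.cast_add, add_comm] at hk
          simpa [List.countP_cons, ha] using hk
        · simpa [List.countP_cons, ha] using ih (k + 1)
      calc prob P (PropSampling.replicate (n + 1) m) {l | k + 1 ≤ l.countP p} * 3 ^ (n + 1)
          = mean P m (fun a => prob P (PropSampling.replicate n m)
              {l | k + 1 ≤ (a :: l).countP p} * 3 ^ n) * 3 := by
            rw [prob, hm.mean_replicate_succ, hm.mean_mul_const, mul_assoc, pow_succ]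
            rfl
        _ ≤ (prob P m {a | p a} * D + binomialTail n (k + 1)) * 3 := by
            gcongr
            refine (mean_mono hstep).trans ?_
            rw [hm.mean_add, hm.mean_mul_const]
            exact add_le_add_right (hm.mean_const_le _) _
        _ ≤ (1 / 3 * D + binomialTail n (k + 1)) * 3 := by gcongr
        _ = binomialTail (n + 1) (k + 1) := by
            rw [add_mul, mul_right_comm, ENNReal.div_mul_cancel (by norm_num) (by norm_num),
              binomialTail, hD]
            push_cast
            ring

variable [LinearOrder α] [Inhabited α]

lemma Fresh.amplify (hm : Fresh P m) : Fresh P (amplify m) :=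
  (hm.replicate 15).bind fun _ => Fresh.pure _

lemma Proper.amplify (hm : Proper P m) : Proper P (amplify m) :=
  (hm.replicate 15).bind fun _ => Proper.pure _

lemma Fresh.mean_amplify (hm : Fresh P m) (g : α → ℝ≥0∞) :
    mean P (PropSampling.amplify m) g =
      mean P (PropSampling.replicate 15 m) fun l => g (median l) :=
  (hm.replicate 15).mean_bind_pure _ _

lemma Fresh.cost_amplify_le (hm : Fresh P m) :
    cost P (PropSampling.amplify m) ≤ 15 * cost P m :=
  ((hm.replicate 15).cost_bind_pure_le _).trans (hm.cost_replicate_le 15)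

lemma Fresh.mean_amplify_le (hm : Fresh P m) (g : α → ℝ≥0∞) :
    mean P (PropSampling.amplify m) g ≤ 15 * mean P m g := by
  rw [hm.mean_amplify]
  refine (hm.mean_replicate_mono 15 fun l hl => ?_).trans (hm.mean_replicate_sum_le 15 g)
  exact List.le_sum_of_mem (List.mem_map_of_mem (median_mem (by rintro rfl; simp at hl)))

lemma Fresh.prob_amplify_compl_le (hm : Fresh P m) {s : Set α} (hs : s.OrdConnected)
    (h : prob P m sᶜ ≤ 1 / 3) : prob P (PropSampling.amplify m) sᶜ ≤ 1 / 10 := by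
  classical
  have hmajority : prob P (PropSampling.amplify m) sᶜ ≤
      prob P (PropSampling.replicate 15 m) {l | 8 ≤ l.countP (· ∉ s)} := by
    rw [prob, hm.mean_amplify]
    refine hm.mean_replicate_mono 15 fun l hl => Set.indicator_apply_le' (fun hmem => ?_)
      fun _ => zero_le
    exact (Set.indicator_of_mem (s := {l | 8 ≤ l.countP (· ∉ s)}) (f := (1 : List α → ℝ≥0∞))
      (succ_le_countP_of_median_notMem hs (n := 7) hl hmem)).ge
  have htail : (binomialTail 15 8 : ℝ≥0∞) * 10 ≤ 3 ^ 15 := by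
    exact_mod_cast (by decide +kernel : binomialTail 15 8 * 10 ≤ 3 ^ 15)
  refine hmajority.trans ((ENNReal.le_div_iff_mul_le (by norm_num) (by norm_num)).2 ?_)
  refine (ENNReal.mul_le_mul_iff_left (c := 3 ^ 15) (by positivity) (by norm_num)).1 ?_
  calc _ = prob P (PropSampling.replicate 15 m) {l | 8 ≤ l.countP (· ∉ s)} * 3 ^ 15 * 10 :=
        mul_right_comm _ _ _
    _ ≤ binomialTail 15 8 * 10 := by gcongr; exact hm.prob_replicate_countP_mul_le h 15 8
    _ ≤ 1 * 3 ^ 15 := by rwa [one_mul]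

end TapeLaw

/-! ### The law of the tape -/

lemma measurePreserving_head_tail {X : Type} [MeasurableSpace X] (μ : Measure X)
    [IsProbabilityMeasure μ] :
    MeasurePreserving (fun f : ℕ → X => (f 0, fun i => f (i + 1)))
      (Measure.infinitePi fun _ => μ) (μ.prod (Measure.infinitePi fun _ => μ)) where
  measurable := by fun_prop
  map_eq := by
    let π := Measure.infinitePi fun _ : ℕ => μ
    have hindep : ProbabilityTheory.IndepFun (fun f : ℕ → X => f 0) (fun f i => f (i + 1)) π := by
      have h := ProbabilityTheory.iIndepFun_infinitePi (P := fun _ : ℕ => μ)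
        (X := fun _ => id) fun _ => measurable_id
      have := ProbabilityTheory.indep_iSup_of_disjoint (fun i => (measurable_pi_apply i).comap_le)
        h (S := {0}) (T := Set.range Nat.succ) (by simp)
      refine ProbabilityTheory.indep_of_indep_of_le_left
        (ProbabilityTheory.indep_of_indep_of_le_right this ?_) ?_
      · rw [iSup_range, MeasurableSpace.pi, MeasurableSpace.comap_iSup]
        simp only [MeasurableSpace.comap_comp]
        rfl
      · simp only [Set.mem_singleton_iff, iSup_iSup_eq_left]
        rfl
    rw [hindep.map_prod_eq_prod_map_map (measurable_pi_apply 0).aemeasurable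
        (measurable_pi_lambda _ fun i => measurable_pi_apply (i + 1)).aemeasurable,
      Measure.infinitePi_map_eval,
      Measure.map_infinitePi_infinitePi_of_inj (P := fun _ => μ) Nat.succ_injective]

section

variable [Fintype U] [MeasurableSpace U] (w : U → ℝ≥0) (hw : 0 < ∑ a, w a)

instance : IsProbabilityMeasure (propPMF w hw).toMeasure := PMF.toMeasure.isProbabilityMeasure _

instance : IsProbabilityMeasure (randomness w hw) := by unfold randomness; infer_instance

lemma measurePreserving_first_sample :
    MeasurePreserving (fun ω : (ℕ → U) × (ℕ → unitInterval) =>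
        (ω.1 0, (fun i => ω.1 (i + 1)), ω.2))
      (randomness w hw) ((propPMF w hw).toMeasure.prod (randomness w hw)) :=
  (measurePreserving_prodAssoc _ _ _).comp
    ((measurePreserving_head_tail (propPMF w hw).toMeasure).prod (MeasurePreserving.id _))

lemma measurePreserving_first_coin :
    MeasurePreserving (fun ω : (ℕ → U) × (ℕ → unitInterval) =>
        (ω.2 0, ω.1, fun i => ω.2 (i + 1)))
      (randomness w hw) ((volume : Measure unitInterval).prod (randomness w hw)) :=
  (((MeasurePreserving.id _).prod Measure.measurePreserving_swap).comp
    ((measurePreserving_prodAssoc _ _ _).comp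
      ((measurePreserving_head_tail volume).prod (MeasurePreserving.id _)))).comp
    Measure.measurePreserving_swap

end

/-- The σ-algebra on tapes generated by reading them as the samples and the coins. -/
@[reducible] def tapeSpace [MeasurableSpace U] (w : U → ℝ≥0) : MeasurableSpace (Tape U) :=
  MeasurableSpace.map (tapeOf w) inferInstance

lemma measurable_tapeOf [MeasurableSpace U] (w : U → ℝ≥0) :
    Measurable[_, tapeSpace w] (tapeOf w) := fun _ h => h

lemma measurable_comp_tapeOf [MeasurableSpace U] {w : U → ℝ≥0} {F : Tape U → ℝ≥0∞} :
    (Measurable fun ω => F (tapeOf w ω)) ↔ Measurable[tapeSpace w] F := Iff.rfl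

section

variable [Fintype U] [MeasurableSpace U] {w : U → ℝ≥0} {hw : 0 < ∑ a, w a}

/-- The law of the tape on which a program is executed. -/
def tapeLaw (w : U → ℝ≥0) (hw : 0 < ∑ a, w a) : @Measure (Tape U) (tapeSpace w) :=
  letI := tapeSpace w
  (randomness w hw).map (tapeOf w)

instance : @IsProbabilityMeasure _ (tapeSpace w) (tapeLaw w hw) :=
  letI := tapeSpace w
  Measure.isProbabilityMeasure_map (measurable_tapeOf w).aemeasurable

lemma lintegral_tapeLaw {F : Tape U → ℝ≥0∞} (hF : Measurable[tapeSpace w] F) :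
    ∫⁻ t, F t ∂tapeLaw w hw = ∫⁻ ω, F (tapeOf w ω) ∂randomness w hw :=
  letI := tapeSpace w
  lintegral_map hF (measurable_tapeOf w)

end

/-! ### Drawing a sample and tossing a coin -/

lemma propPMF_apply [Fintype U] (w : U → ℝ≥0) (hw : 0 < ∑ a, w a) (a : U) :
    propPMF w hw a = ((w a / ∑ x, w x : ℝ≥0) : ℝ≥0∞) := rfl

lemma sum_propPMF [Fintype U] (w : U → ℝ≥0) (hw : 0 < ∑ a, w a) : ∑ a, propPMF w hw a = 1 := by
  rw [← (propPMF w hw).tsum_coe, tsum_fintype]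

section Draw

variable [MeasurableSpace U] [MeasurableSingletonClass U] {w : U → ℝ≥0}

lemma measurable_after_draw [Countable U] {H : U × ℝ → ℕ → Tape U → ℝ≥0∞}
    (hH : ∀ a c, Measurable[tapeSpace w] (H a c)) :
    Measurable fun p : U × ((ℕ → U) × (ℕ → unitInterval)) => H (p.1, w p.1) 1 (tapeOf w p.2) :=
  measurable_from_prod_countable_right fun a => measurable_comp_tapeOf.2 (hH (a, w a) 1)

lemma measurable_onHalt_draw [Countable U] {H : U × ℝ → ℕ → Tape U → ℝ≥0∞}
    (hH : ∀ a c, Measurable[tapeSpace w] (H a c)) :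
    Measurable[tapeSpace w] fun t => onHalt H (draw t) :=
  measurable_comp_tapeOf.1 ((measurable_after_draw hH).comp
    (by fun_prop : Measurable fun ω : (ℕ → U) × (ℕ → unitInterval) =>
      (ω.1 0, (fun i => ω.1 (i + 1)), ω.2)))

variable [Fintype U] {hw : 0 < ∑ a, w a}

lemma lintegral_onHalt_draw {H : U × ℝ → ℕ → Tape U → ℝ≥0∞}
    (hH : ∀ a c, Measurable[tapeSpace w] (H a c)) :
    ∫⁻ t, onHalt H (draw t) ∂tapeLaw w hw =
      ∑ a, propPMF w hw a * ∫⁻ t, H (a, w a) 1 t ∂tapeLaw w hw := by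
  have hH' := measurable_after_draw hH
  calc ∫⁻ t, onHalt H (draw t) ∂tapeLaw w hw
      = ∫⁻ p, H (p.1, w p.1) 1 (tapeOf w p.2)
          ∂(propPMF w hw).toMeasure.prod (randomness w hw) := by
        rw [lintegral_tapeLaw (measurable_onHalt_draw hH)]
        exact (measurePreserving_first_sample w hw).lintegral_comp hH'
    _ = ∑ a, propPMF w hw a * ∫⁻ t, H (a, w a) 1 t ∂tapeLaw w hw := by
        rw [lintegral_prod _ hH'.aemeasurable, lintegral_fintype]
        refine Finset.sum_congr rfl fun a _ => ?_
        rw [PMF.toMeasure_apply_singleton _ _ (measurableSet_singleton a), mul_comm,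
          lintegral_tapeLaw (hH _ _)]

lemma expect_draw (G : U × ℝ → ℕ → ℝ≥0∞) :
    expect (tapeLaw w hw) draw G = ∑ a, propPMF w hw a * G (a, w a) 1 := by
  unfold expect
  rw [lintegral_onHalt_draw fun _ _ => @measurable_const _ _ _ (tapeSpace w) _]
  simp only [lintegral_const, measure_univ, mul_one]

lemma mean_draw (g : U × ℝ → ℝ≥0∞) :
    mean (tapeLaw w hw) draw g = ∑ a, propPMF w hw a * g (a, w a) := expect_draw _

lemma cost_draw : cost (tapeLaw w hw) draw = 1 := by
  simp only [cost, expect_draw, Nat.cast_one, mul_one, sum_propPMF]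

lemma Proper.draw : Proper (tapeLaw w hw) draw where
  measurable _ hH := measurable_onHalt_draw hH
  lintegral H hH := by rw [lintegral_onHalt_draw hH, expect_draw]
  mean_one := by simp only [mean_draw, mul_one, sum_propPMF]

end Draw

/-- Branch on whether a private random number exceeds a threshold. -/
def coinBranch (q : ℝ) (x y : α) : Prog U α := do
  let u ← uniform
  if u > q then pure x else pure y

lemma onHalt_coinBranch (H : α → ℕ → Tape U → ℝ≥0∞) (q : ℝ) (x y : α) (t : Tape U) :
    onHalt H (coinBranch q x y t) =
      H (if (t.coin 0 : ℝ) > q then x else y) 0 ⟨t.sample, fun i => t.coin (i + 1)⟩ := by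
  rw [coinBranch, onHalt_bind, uniform, onHalt_some]
  split_ifs <;> rfl

section Coin

variable [MeasurableSpace U] {w : U → ℝ≥0}

lemma measurable_after_coin {H : α → ℕ → Tape U → ℝ≥0∞}
    (hH : ∀ a c, Measurable[tapeSpace w] (H a c)) (q : ℝ) (x y : α) :
    Measurable fun p : unitInterval × ((ℕ → U) × (ℕ → unitInterval)) =>
      H (if (p.1 : ℝ) > q then x else y) 0 (tapeOf w p.2) := by
  simp only [apply_ite H, ite_apply]
  exact Measurable.ite (measurableSet_lt measurable_const (by fun_prop))
    ((measurable_comp_tapeOf.2 (hH x 0)).comp measurable_snd)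
    ((measurable_comp_tapeOf.2 (hH y 0)).comp measurable_snd)

lemma measurable_onHalt_coinBranch {H : α → ℕ → Tape U → ℝ≥0∞}
    (hH : ∀ a c, Measurable[tapeSpace w] (H a c)) (q : ℝ) (x y : α) :
    Measurable[tapeSpace w] fun t => onHalt H (coinBranch q x y t) := by
  simp only [onHalt_coinBranch]
  exact measurable_comp_tapeOf.1 ((measurable_after_coin hH q x y).comp
    (by fun_prop : Measurable fun ω : (ℕ → U) × (ℕ → unitInterval) =>
      (ω.2 0, ω.1, fun i => ω.2 (i + 1))))

variable [Fintype U] {hw : 0 < ∑ a, w a}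

lemma lintegral_onHalt_coinBranch {H : α → ℕ → Tape U → ℝ≥0∞}
    (hH : ∀ a c, Measurable[tapeSpace w] (H a c)) (q : ℝ) (x y : α) :
    ∫⁻ t, onHalt H (coinBranch q x y t) ∂tapeLaw w hw =
      ∫⁻ u : unitInterval, ∫⁻ t, H (if (u : ℝ) > q then x else y) 0 t ∂tapeLaw w hw := by
  have hH' := measurable_after_coin hH q x y
  calc ∫⁻ t, onHalt H (coinBranch q x y t) ∂tapeLaw w hw
      = ∫⁻ p, H (if (p.1 : ℝ) > q then x else y) 0 (tapeOf w p.2)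
          ∂(volume : Measure unitInterval).prod (randomness w hw) := by
        rw [lintegral_tapeLaw (measurable_onHalt_coinBranch hH q x y)]
        simp only [onHalt_coinBranch]
        exact (measurePreserving_first_coin w hw).lintegral_comp hH'
    _ = ∫⁻ u : unitInterval, ∫⁻ t, H (if (u : ℝ) > q then x else y) 0 t ∂tapeLaw w hw := by
        rw [lintegral_prod _ hH'.aemeasurable]
        simp only [lintegral_tapeLaw (hH _ _)]

lemma expect_coinBranch (q : ℝ) (x y : α) (G : α → ℕ → ℝ≥0∞) :
    expect (tapeLaw w hw) (coinBranch q x y) G =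
      ∫⁻ u : unitInterval, G (if (u : ℝ) > q then x else y) 0 := by
  unfold expect
  rw [lintegral_onHalt_coinBranch fun _ _ => @measurable_const _ _ _ (tapeSpace w) _]
  simp only [lintegral_const, measure_univ, mul_one]

lemma cost_coinBranch (q : ℝ) (x y : α) : cost (tapeLaw w hw) (coinBranch q x y) = 0 := by
  simp only [cost, expect_coinBranch, Nat.cast_zero, lintegral_zero]

lemma Proper.coinBranch (q : ℝ) (x y : α) :
    Proper (tapeLaw w hw) (coinBranch q x y) where
  measurable _ hH := measurable_onHalt_coinBranch hH q x y
  lintegral H hH := by rw [lintegral_onHalt_coinBranch hH, expect_coinBranch]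
  mean_one := by simp only [mean, expect_coinBranch, lintegral_const, measure_univ, mul_one]

lemma mean_coinBranch {q : ℝ} (hq : q ∈ unitInterval) (x y : α) (g : α → ℝ≥0∞) :
    mean (tapeLaw w hw) (coinBranch q x y) g =
      ENNReal.ofReal (1 - q) * g x + ENNReal.ofReal q * g y := by
  calc mean (tapeLaw w hw) (coinBranch q x y) g
      = ∫⁻ u : unitInterval, (Set.Ioi ⟨q, hq⟩).indicator (fun _ => g x) u +
          (Set.Iic ⟨q, hq⟩).indicator (fun _ => g y) u := by
        rw [mean, expect_coinBranch]
        refine lintegral_congr fun u => ?_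
        by_cases hu : q < u <;>
          simp [← Subtype.coe_lt_coe, ← Subtype.coe_le_coe, hu, le_of_not_gt]
    _ = ENNReal.ofReal (1 - q) * g x + ENNReal.ofReal q * g y := by
        rw [lintegral_add_left (measurable_const.indicator measurableSet_Ioi),
          lintegral_indicator_const measurableSet_Ioi, lintegral_indicator_const measurableSet_Iic,
          unitInterval.volume_Ioi, unitInterval.volume_Iic, mul_comm, mul_comm (g y)]

end Coin

/-! ### Rejection sampling -/

section TapeLaw

variable {mT : MeasurableSpace (Tape U)} {P : Measure (Tape U)}

/-- The program returns an item of `B` together with its weight, the item `a` being chosen with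
probability `p a`. It suffices to bound the expectations from above, as both sides have mass one. -/
structure Samples (P : Measure (Tape U)) (w : U → ℝ≥0) (B : Finset U) (p : U → ℝ≥0∞)
    (m : Prog U (U × ℝ)) : Prop extends Proper P m where
  sum_eq_one : ∑ a ∈ B, p a = 1
  mean_le (g : U × ℝ → ℝ≥0∞) : mean P m g ≤ ∑ a ∈ B, p a * g (a, w a)

/-- A test of a sampled item at no cost, accepting the item `a` of `B` with probability `c a`. -/
structure Accepts (P : Measure (Tape U)) (w : U → ℝ≥0) (B : Finset U) (c : U → ℝ≥0∞)
    (test : U × ℝ → Prog U (Unit ⊕ U × ℝ)) : Prop where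
  proper (x : U × ℝ) : Proper P (test x)
  cost_eq_zero (x : U × ℝ) : cost P (test x) = 0
  le_one (a : U) : a ∈ B → c a ≤ 1
  mean_le (a : U) : a ∈ B → ∀ g : Unit ⊕ U × ℝ → ℝ≥0∞,
    mean P (test (a, w a)) g ≤ (1 - c a) * g (.inl ()) + c a * g (.inr (a, w a))

variable {w : U → ℝ≥0} {B : Finset U} {p c : U → ℝ≥0∞} {m : Prog U (U × ℝ)}
  {test : U × ℝ → Prog U (Unit ⊕ U × ℝ)}

lemma Samples.nonempty (hm : Samples P w B p m) : B.Nonempty := by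
  by_contra! h
  simpa [h] using hm.sum_eq_one

lemma Samples.of_subset {C : Finset U} (hm : Samples P w C p m) (hBC : B ⊆ C)
    (hp : ∀ a ∈ C, a ∉ B → p a = 0) : Samples P w B p m where
  toProper := hm.toProper
  sum_eq_one := (Finset.sum_subset hBC hp).trans hm.sum_eq_one
  mean_le g := (hm.mean_le g).trans_eq
    (Finset.sum_subset hBC fun a ha hB => by rw [hp a ha hB, zero_mul]).symm

lemma Samples.congr {q : U → ℝ≥0∞} (hm : Samples P w B p m) (hpq : ∀ a ∈ B, p a = q a) :
    Samples P w B q m where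
  toProper := hm.toProper
  sum_eq_one := (Finset.sum_congr rfl hpq).symm.trans hm.sum_eq_one
  mean_le g := (hm.mean_le g).trans_eq (Finset.sum_congr rfl fun a ha => by rw [hpq a ha])

lemma Samples.sum_reject_add_sum_accept (hm : Samples P w B p m) (ht : Accepts P w B c test) :
    (∑ a ∈ B, p a * (1 - c a)) + ∑ a ∈ B, p a * c a = 1 := by
  rw [← Finset.sum_add_distrib]
  refine (Finset.sum_congr rfl fun a ha => ?_).trans hm.sum_eq_one
  rw [← mul_add, tsub_add_cancel_of_le (ht.le_one a ha), mul_one]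

lemma Samples.mean_bind_test_le (hm : Samples P w B p m) (ht : Accepts P w B c test) (r : ℝ≥0∞)
    (g : U × ℝ → ℝ≥0∞) :
    mean P (m >>= test) (Sum.elim (fun _ => r) g) ≤
      (∑ a ∈ B, p a * (1 - c a)) * r + ∑ a ∈ B, p a * c a * g (a, w a) := by
  rw [hm.mean_bind fun x => (ht.proper x).toFresh, Finset.sum_mul, ← Finset.sum_add_distrib]
  refine (hm.mean_le _).trans (Finset.sum_le_sum fun a ha => ?_)
  rw [mul_assoc, mul_assoc, ← mul_add]
  gcongr
  exact ht.mean_le a ha _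

/-- The function `x / z` solves the recursion for the expected total charge of a loop that
terminates with probability `z` after each round and charges `x` per round. -/
lemma add_mul_div_eq {r z : ℝ≥0∞} (hrz : r + z = 1) (hz : z ≠ 0) (x : ℝ≥0∞) :
    x + r * (x / z) = x / z := by
  have hz' : z ≠ ⊤ := ne_top_of_le_ne_top ENNReal.one_ne_top (hrz ▸ le_add_self)
  calc x + r * (x / z) = x / z * z + r * (x / z) := by rw [ENNReal.div_mul_cancel hz hz']
    _ = x / z * (r + z) := by ring
    _ = x / z := by rw [hrz, mul_one]

variable [IsProbabilityMeasure P]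

lemma Samples.cost_loop_test_le (hm : Samples P w B p m) (ht : Accepts P w B c test)
    (hz : ∑ a ∈ B, p a * c a ≠ 0) :
    cost P (loop (fun _ : Unit => m >>= test) ()) ≤ cost P m / ∑ a ∈ B, p a * c a := by
  refine cost_loop_le (fun _ => hm.toFresh.bind fun x => (ht.proper x).toFresh)
    (Φ := fun _ => cost P m / ∑ a ∈ B, p a * c a) (fun _ => ?_) ()
  have hcost : cost P (m >>= test) ≤ cost P m := by
    refine (hm.cost_bind_le fun x => (ht.proper x).toFresh).trans_eq ?_
    simp only [ht.cost_eq_zero, hm.mean_const, add_zero]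
  refine (add_le_add hcost (hm.mean_bind_test_le ht _ _)).trans_eq ?_
  simp only [mul_zero, Finset.sum_const_zero, add_zero]
  exact add_mul_div_eq (hm.sum_reject_add_sum_accept ht) hz _

lemma Samples.loop_test (hm : Samples P w B p m) (ht : Accepts P w B c test)
    (hz : ∑ a ∈ B, p a * c a ≠ 0) :
    Samples P w B (fun a => p a * c a / ∑ x ∈ B, p x * c x)
      (loop (fun _ : Unit => m >>= test) ()) where
  toProper := by
    refine Proper.loop (fun _ => hm.toProper.bind ht.proper)
      (Φ := fun _ => 1 / ∑ a ∈ B, p a * c a) (fun _ => ?_)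
      (ENNReal.div_ne_top ENNReal.one_ne_top hz)
    refine (add_le_add_right (hm.mean_bind_test_le ht _ _) _).trans_eq ?_
    simp only [mul_zero, Finset.sum_const_zero, add_zero]
    exact add_mul_div_eq (hm.sum_reject_add_sum_accept ht) hz _
  sum_eq_one := by
    simp only [div_eq_mul_inv, ← Finset.sum_mul]
    exact ENNReal.mul_inv_cancel hz (ne_top_of_le_ne_top ENNReal.one_ne_top
      (hm.sum_reject_add_sum_accept ht ▸ le_add_self))
  mean_le g := by
    have hdiv : ∑ a ∈ B, p a * c a / (∑ x ∈ B, p x * c x) * g (a, w a) =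
        (∑ a ∈ B, p a * c a * g (a, w a)) / ∑ x ∈ B, p x * c x := by
      simp only [div_eq_mul_inv, Finset.sum_mul, mul_right_comm]
    rw [hdiv]
    refine mean_loop_le (fun _ => hm.toFresh.bind fun x => (ht.proper x).toFresh)
      (Φ := fun _ => (∑ a ∈ B, p a * c a * g (a, w a)) / ∑ x ∈ B, p x * c x) (fun _ => ?_) ()
    refine (hm.mean_bind_test_le ht _ _).trans_eq ?_
    rw [add_comm]
    exact add_mul_div_eq (hm.sum_reject_add_sum_accept ht) hz _

end TapeLaw

/-! ### Sampling from a bucket -/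

section Bucket

variable [Fintype U]

/-- The items with weight in `[2 ^ b, 2 ^ (b + 1))`. -/
def bucket (w : U → ℝ≥0) (b : ℤ) : Finset U :=
  Finset.univ.filter fun a => (w a : ℝ) ∈ Set.Ico ((2 : ℝ) ^ b) ((2 : ℝ) ^ (b + 1))

/-- The total weight of a bucket. -/
def bucketWeight (w : U → ℝ≥0) (b : ℤ) : ℝ≥0 := ∑ a ∈ bucket w b, w a

/-- The probability that a proportional sample falls in a bucket. -/
def bucketProb (w : U → ℝ≥0) (b : ℤ) : ℝ≥0 := bucketWeight w b / ∑ a, w a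

variable {w : U → ℝ≥0} {b : ℤ} {a : U}

lemma mem_bucket : a ∈ bucket w b ↔ (w a : ℝ) ∈ Set.Ico ((2 : ℝ) ^ b) ((2 : ℝ) ^ (b + 1)) := by
  simp [bucket]

lemma weight_pos_of_mem_bucket (h : a ∈ bucket w b) : 0 < w a := by
  have h1 : (0 : ℝ) < 2 ^ b := by positivity
  exact_mod_cast h1.trans_le (mem_bucket.1 h).1

lemma bucketWeight_pos (h : (bucket w b).Nonempty) : 0 < bucketWeight w b :=
  Finset.sum_pos (fun _ ha => weight_pos_of_mem_bucket ha) h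

lemma bucketWeight_le_sum (w : U → ℝ≥0) (b : ℤ) : bucketWeight w b ≤ ∑ a, w a :=
  Finset.sum_le_univ_sum_of_nonneg fun _ => zero_le

lemma bucketProb_pos (h : (bucket w b).Nonempty) : 0 < bucketProb w b :=
  div_pos (bucketWeight_pos h) ((bucketWeight_pos h).trans_le (bucketWeight_le_sum w b))

lemma bucketProb_le_one (w : U → ℝ≥0) (b : ℤ) : bucketProb w b ≤ 1 :=
  div_le_one_of_le₀ (bucketWeight_le_sum w b) zero_le

lemma two_zpow_div_weight_mem_Icc (ha : a ∈ bucket w b) :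
    (2 : ℝ≥0) ^ b / w a ∈ Set.Icc (1 / 2) 1 := by
  have hpos := weight_pos_of_mem_bucket ha
  obtain ⟨hle, hlt⟩ := mem_bucket.1 ha
  have hlt' : w a < 2 ^ b * 2 := by
    rw [zpow_add_one₀ two_ne_zero] at hlt
    exact_mod_cast hlt
  refine ⟨?_, div_le_one_of_le₀ (by exact_mod_cast hle) zero_le⟩
  rw [div_le_div_iff₀ two_pos hpos, one_mul]
  exact hlt'.le

lemma sum_propPMF_bucket (hw : 0 < ∑ a, w a) (b : ℤ) :
    ∑ a ∈ bucket w b, propPMF w hw a = bucketProb w b := by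
  simp only [propPMF_apply, ← ENNReal.ofNNReal_finsetSum, ← Finset.sum_div]
  rfl

lemma sum_propPMF_mul_indicator (hw : 0 < ∑ a, w a) (b : ℤ) :
    ∑ a, propPMF w hw a * (bucket w b : Set U).indicator 1 a = bucketProb w b := by
  classical
  simp only [← sum_propPMF_bucket hw, Set.indicator_apply, Finset.mem_coe, Pi.one_apply, mul_ite,
    mul_one, mul_zero, Finset.sum_ite_mem, Finset.univ_inter]

lemma weight_div_mul_two_zpow_div (ha : a ∈ bucket w b) :
    ((w a / bucketWeight w b : ℝ≥0) : ℝ≥0∞) * ((2 ^ b / w a : ℝ≥0) : ℝ≥0∞) =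
      ((2 ^ b / bucketWeight w b : ℝ≥0) : ℝ≥0∞) := by
  have hpos := (weight_pos_of_mem_bucket ha).ne'
  rw [← ENNReal.coe_mul]
  congr 1
  field_simp

lemma sum_weight_div_bucketWeight (hb : (bucket w b).Nonempty) :
    ∑ a ∈ bucket w b, ((w a / bucketWeight w b : ℝ≥0) : ℝ≥0∞) = 1 := by
  rw [← ENNReal.ofNNReal_finsetSum, ← Finset.sum_div, ENNReal.coe_eq_one]
  exact div_self (bucketWeight_pos hb).ne'

lemma one_half_le_sum_weight_div_mul (hb : (bucket w b).Nonempty) :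
    1 / 2 ≤ ∑ a ∈ bucket w b,
      ((w a / bucketWeight w b : ℝ≥0) : ℝ≥0∞) * ((2 ^ b / w a : ℝ≥0) : ℝ≥0∞) := by
  have hhalf : (1 / 2 : ℝ≥0∞) = ((1 / 2 : ℝ≥0) : ℝ≥0∞) := by simp
  rw [hhalf, ← one_mul (ENNReal.ofNNReal _), ← sum_weight_div_bucketWeight hb, Finset.sum_mul]
  refine Finset.sum_le_sum fun a ha => mul_le_mul_right ?_ _
  exact ENNReal.coe_le_coe.2 (two_zpow_div_weight_mem_Icc ha).1

variable [MeasurableSpace U] {hw : 0 < ∑ a, w a}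

lemma accepts_bucket (b : ℤ) :
    Accepts (tapeLaw w hw) w Finset.univ ((bucket w b : Set U).indicator 1) fun x =>
      if x.2 ∈ Set.Ico ((2 : ℝ) ^ b) ((2 : ℝ) ^ (b + 1)) then pure (.inr x)
      else pure (.inl ()) where
  proper x := by split_ifs <;> exact Proper.pure _
  cost_eq_zero x := by split_ifs <;> exact cost_pure _
  le_one a _ := Set.indicator_le_self' (fun _ _ => zero_le) a
  mean_le a _ g := by
    by_cases ha : a ∈ bucket w b
    · rw [if_pos (mem_bucket.1 ha), mean_pure]
      simp [ha]
    · rw [if_neg (mt mem_bucket.2 ha), mean_pure]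
      simp [ha]

lemma accepts_coinBranch (b : ℤ) :
    Accepts (tapeLaw w hw) w (bucket w b) (fun a => ((2 ^ b / w a : ℝ≥0) : ℝ≥0∞)) fun x =>
      coinBranch ((2 : ℝ) ^ b / x.2) (.inl ()) (.inr x) where
  proper _ := Proper.coinBranch _ _ _
  cost_eq_zero _ := cost_coinBranch _ _ _
  le_one a ha := by exact_mod_cast (two_zpow_div_weight_mem_Icc ha).2
  mean_le a ha g := by
    have h := (two_zpow_div_weight_mem_Icc ha).2
    have hcoe : (2 : ℝ) ^ b / w a = ((2 ^ b / w a : ℝ≥0) : ℝ) := by push_cast; rfl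
    rw [hcoe, mean_coinBranch ⟨NNReal.coe_nonneg _, by exact_mod_cast h⟩,
      ENNReal.ofReal_sub _ (NNReal.coe_nonneg _), ENNReal.ofReal_one, ENNReal.ofReal_coe_nnreal]

variable [MeasurableSingletonClass U]

lemma fresh_propBucketSampler (b : ℤ) :
    Fresh (tapeLaw w hw) (propBucketSampler b) :=
  Fresh.loop (fun _ => Proper.draw.toFresh.bind fun x =>
    ((accepts_bucket (hw := hw) b).proper x).toFresh) ()

lemma fresh_unifBucketSampler (b : ℤ) :
    Fresh (tapeLaw w hw) (unifBucketSampler b) :=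
  Fresh.loop (fun _ => (fresh_propBucketSampler b).bind fun x =>
    ((accepts_coinBranch (hw := hw) b).proper x).toFresh) ()

lemma samples_draw : Samples (tapeLaw w hw) w Finset.univ (propPMF w hw) draw :=
  ⟨Proper.draw, sum_propPMF w hw, fun g => (mean_draw g).le⟩

lemma cost_propBucketSampler_le (hb : (bucket w b).Nonempty) :
    cost (tapeLaw w hw) (propBucketSampler b) ≤ 1 / bucketProb w b := by
  have h := sum_propPMF_mul_indicator hw b
  rw [← h, ← cost_draw (hw := hw)]
  exact samples_draw.cost_loop_test_le (accepts_bucket b)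
    (by simpa [h] using (bucketProb_pos hb).ne')

lemma samples_propBucketSampler (hb : (bucket w b).Nonempty) :
    Samples (tapeLaw w hw) w (bucket w b) (fun a => ((w a / bucketWeight w b : ℝ≥0) : ℝ≥0∞))
      (propBucketSampler b) := by
  have h := sum_propPMF_mul_indicator hw b
  have hs := samples_draw.loop_test (accepts_bucket (hw := hw) b)
    (by simpa [h] using (bucketProb_pos hb).ne')
  refine (hs.of_subset (Finset.subset_univ _) fun a _ ha => by simp [ha]).congr fun a ha => ?_
  have hp := (bucketProb_pos hb).ne'
  have hW := (bucketWeight_pos hb).ne'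
  rw [h, Set.indicator_of_mem (Finset.mem_coe.2 ha), Pi.one_apply, mul_one, propPMF_apply,
    ← ENNReal.coe_div hp, bucketProb]
  congr 1
  field_simp

lemma cost_unifBucketSampler_le (hb : (bucket w b).Nonempty) :
    cost (tapeLaw w hw) (unifBucketSampler b) ≤ 2 / bucketProb w b := by
  have h := one_half_le_sum_weight_div_mul hb
  have hz := ((by norm_num : (0 : ℝ≥0∞) < 1 / 2).trans_le h).ne'
  calc cost (tapeLaw w hw) (unifBucketSampler b)
      ≤ cost (tapeLaw w hw) (propBucketSampler b) / _ :=
        (samples_propBucketSampler hb).cost_loop_test_le (accepts_coinBranch b) hz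
    _ ≤ (1 / bucketProb w b) / (1 / 2) := ENNReal.div_le_div (cost_propBucketSampler_le hb) h
    _ = 2 / bucketProb w b := by simp [div_eq_mul_inv, mul_comm]

lemma samples_unifBucketSampler (hb : (bucket w b).Nonempty) :
    Samples (tapeLaw w hw) w (bucket w b) (fun _ => ((bucket w b).card : ℝ≥0∞)⁻¹)
      (unifBucketSampler b) := by
  have hz := ((by norm_num : (0 : ℝ≥0∞) < 1 / 2).trans_le (one_half_le_sum_weight_div_mul hb)).ne'
  refine ((samples_propBucketSampler hb).loop_test (accepts_coinBranch b) hz).congr fun a ha => ?_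
  have hγ : (2 ^ b / bucketWeight w b : ℝ≥0) ≠ 0 := by
    have := bucketWeight_pos hb
    positivity
  rw [Finset.sum_congr rfl fun a ha => weight_div_mul_two_zpow_div ha,
    weight_div_mul_two_zpow_div ha, Finset.sum_const, nsmul_eq_mul, ← one_div,
    ← ENNReal.mul_div_mul_right 1 _ (ENNReal.coe_ne_zero.2 hγ) ENNReal.coe_ne_top, one_mul]

end Bucket

/-! ### Estimating the size of a bucket -/

lemma ofReal_mul_add_ofReal_mul_le {q x y z : ℝ} (hq : q ∈ unitInterval) (hx : 0 ≤ x) (hy : 0 ≤ y)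
    (h : q * x + (1 - q) * y ≤ z) :
    ENNReal.ofReal q * ENNReal.ofReal x + ENNReal.ofReal (1 - q) * ENNReal.ofReal y ≤
      ENNReal.ofReal z := by
  have hq' := sub_nonneg.2 hq.2
  rw [← ENNReal.ofReal_mul hq.1, ← ENNReal.ofReal_mul hq',
    ← ENNReal.ofReal_add (mul_nonneg hq.1 hx) (mul_nonneg hq' hy)]
  exact ENNReal.ofReal_le_ofReal h

/-- A bound on the expected number of uniform samples from a set of size `N` until the first
repetition, when `j` distinct items have been seen: once `√N` items have been seen, a repetition
occurs with probability at least `1 / √N` in each round. -/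
def birthdayBound (N j : ℕ) : ℝ := ((⌈√(N : ℝ)⌉₊ - j : ℕ) : ℝ) + √(N : ℝ)

lemma birthdayBound_nonneg (N j : ℕ) : 0 ≤ birthdayBound N j := by
  unfold birthdayBound; positivity

lemma one_add_mul_birthdayBound_succ_le {N j : ℕ} (hN : 0 < N) :
    1 + (1 - (j : ℝ) / N) * birthdayBound N (j + 1) ≤ birthdayBound N j := by
  rcases lt_or_ge j ⌈√(N : ℝ)⌉₊ with hj | hj
  · have hsucc : birthdayBound N j = 1 + birthdayBound N (j + 1) := by
      have hsub : ⌈√(N : ℝ)⌉₊ - j = 1 + (⌈√(N : ℝ)⌉₊ - (j + 1)) := by omega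
      simp only [birthdayBound, hsub]
      push_cast
      ring
    have hq : 0 ≤ (j : ℝ) / N := by positivity
    nlinarith [birthdayBound_nonneg N (j + 1)]
  · have hconst : ∀ i ≥ j, birthdayBound N i = √(N : ℝ) := fun i hi => by
      simp [birthdayBound, Nat.sub_eq_zero_of_le (hj.trans hi)]
    have hone : 1 ≤ (j : ℝ) / N * √(N : ℝ) := by
      rw [div_mul_eq_mul_div, one_le_div (by exact_mod_cast hN)]
      calc (N : ℝ) = √N * √N := (Real.mul_self_sqrt N.cast_nonneg).symm
        _ ≤ j * √N := by gcongr; exact Nat.ceil_le.1 hj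
    rw [hconst j le_rfl, hconst (j + 1) j.le_succ]
    linarith

lemma birthdayBound_zero_le {N : ℕ} (hN : 0 < N) : birthdayBound N 0 ≤ 3 * √(N : ℝ) := by
  have hone : 1 ≤ √(N : ℝ) := Real.one_le_sqrt.2 (by exact_mod_cast hN)
  have hceil := Nat.ceil_lt_add_one (Real.sqrt_nonneg (N : ℝ))
  rw [birthdayBound, Nat.sub_zero]
  linarith

/-- A bound on the probability that the first repetition among uniform samples from a set of size
`N` occurs when fewer than `√N / 2` distinct items have been seen, given that `j` of them have been
seen so far. -/
def earlyRepeatBound (N j : ℕ) : ℝ :=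
  if 4 * j ^ 2 < N then 1 / 3 - (j : ℝ) * (j - 1) / (2 * N) else 0

lemma earlyRepeatBound_succ_le {N j : ℕ} (hj : 4 * j ^ 2 < N) :
    earlyRepeatBound N (j + 1) ≤ 1 / 3 - (j : ℝ) * (j + 1) / (2 * N) := by
  have hN : (0 : ℝ) < N := by exact_mod_cast (Nat.zero_le _).trans_lt hj
  have hsq : 4 * (j : ℝ) ^ 2 < N := by exact_mod_cast hj
  have hle : (j : ℝ) ≤ j ^ 2 := by exact_mod_cast Nat.le_self_pow two_ne_zero j
  unfold earlyRepeatBound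
  split_ifs
  · push_cast
    rw [add_sub_cancel_right, mul_comm (j : ℝ)]
  · rw [sub_nonneg, div_le_div_iff₀ (by positivity) (by norm_num)]
    linarith

lemma earlyRepeatBound_nonneg (N j : ℕ) : 0 ≤ earlyRepeatBound N j := by
  unfold earlyRepeatBound
  split_ifs with hj
  · have hN : (0 : ℝ) < N := by exact_mod_cast (Nat.zero_le _).trans_lt hj
    have hsq : 4 * (j : ℝ) ^ 2 < N := by exact_mod_cast hj
    rw [sub_nonneg, div_le_div_iff₀ (by positivity) (by norm_num)]
    linarith [j.cast_nonneg (α := ℝ)]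
  · exact le_rfl

lemma mul_add_mul_earlyRepeatBound_succ_le (N j : ℕ) :
    (j : ℝ) / N * (if 4 * j ^ 2 < N then 1 else 0) +
      (1 - (j : ℝ) / N) * earlyRepeatBound N (j + 1) ≤ earlyRepeatBound N j := by
  by_cases hlt : 4 * j ^ 2 < N
  · have hN : (0 : ℝ) < N := by exact_mod_cast (Nat.zero_le _).trans_lt hlt
    have hq : 0 ≤ (j : ℝ) / N * earlyRepeatBound N (j + 1) :=
      mul_nonneg (by positivity) (earlyRepeatBound_nonneg _ _)
    have hsplit : (j : ℝ) * (j + 1) / (2 * N) = j / N + j * (j - 1) / (2 * N) := by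
      field_simp
      ring
    have hj' : earlyRepeatBound N j = 1 / 3 - (j : ℝ) * (j - 1) / (2 * N) := if_pos hlt
    rw [if_pos hlt, hj', mul_one, one_sub_mul]
    linarith [earlyRepeatBound_succ_le hlt]
  · have hsucc : ¬ 4 * (j + 1) ^ 2 < N := fun h => hlt (lt_of_le_of_lt (by gcongr; omega) h)
    simp [earlyRepeatBound, hlt, hsucc]

section SetSize

/-- A function of the number of items seen so far as a potential on the states of
`setSizeEstimator`; sets of items outside `B` never occur. -/
def cardPotential [DecidableEq U] (B : Finset U) (φ : ℕ → ℝ≥0∞) (S : Finset U) : ℝ≥0∞ :=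
  if S ⊆ B then φ S.card else ⊤

/-- A round of `setSizeEstimator`. -/
def setRound [DecidableEq U] (m : Prog U (U × ℝ)) (S : Finset U) : Prog U (Finset U ⊕ ℕ) :=
  m >>= fun x => pure (if x.1 ∈ S then .inr (4 * S.card ^ 2) else .inl (insert x.1 S))

lemma natCast_mul_inv_eq_ofReal {N : ℕ} (hN : 0 < N) (k : ℕ) :
    (k : ℝ≥0∞) * (N : ℝ≥0∞)⁻¹ = ENNReal.ofReal ((k : ℝ) / N) := by
  rw [ENNReal.ofReal_div_of_pos (by exact_mod_cast hN), ENNReal.ofReal_natCast,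
    ENNReal.ofReal_natCast, div_eq_mul_inv]

lemma natCast_div_mem_unitInterval {N j : ℕ} (hj : j ≤ N) : (j : ℝ) / N ∈ unitInterval :=
  ⟨by positivity, div_le_one_of_le₀ (by exact_mod_cast hj) (by positivity)⟩

lemma one_add_mul_ofReal_birthdayBound_succ_le {N j : ℕ} (hN : 0 < N) (hj : j ≤ N) :
    1 + ENNReal.ofReal (1 - (j : ℝ) / N) * ENNReal.ofReal (birthdayBound N (j + 1)) ≤
      ENNReal.ofReal (birthdayBound N j) := by
  have hq := sub_nonneg.2 (natCast_div_mem_unitInterval hj).2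
  rw [← ENNReal.ofReal_one, ← ENNReal.ofReal_mul hq,
    ← ENNReal.ofReal_add zero_le_one (mul_nonneg hq (birthdayBound_nonneg _ _))]
  exact ENNReal.ofReal_le_ofReal (one_add_mul_birthdayBound_succ_le hN)

variable {mT : MeasurableSpace (Tape U)} {P : Measure (Tape U)}
  [IsProbabilityMeasure P]
  {w : U → ℝ≥0} {B : Finset U} {m : Prog U (U × ℝ)} [DecidableEq U]

lemma setSizeEstimator_eq_loop (m : Prog U (U × ℝ)) :
    setSizeEstimator m = loop (setRound m) ∅ := by
  unfold setSizeEstimator setRound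
  congr! 4
  split_ifs <;> rfl

lemma Fresh.setRound (hm : Fresh P m) (S : Finset U) : Fresh P (setRound m S) :=
  hm.bind fun _ => Fresh.pure _

lemma Fresh.setSizeEstimator (hm : Fresh P m) : Fresh P (setSizeEstimator m) := by
  rw [setSizeEstimator_eq_loop]
  exact Fresh.loop hm.setRound ∅

lemma Proper.setRound (hm : Proper P m) (S : Finset U) : Proper P (setRound m S) :=
  hm.bind fun _ => Proper.pure _

lemma mean_setRound_le (hm : Samples P w B (fun _ => (B.card : ℝ≥0∞)⁻¹) m) (φ g : ℕ → ℝ≥0∞)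
    {S : Finset U} (hS : S ⊆ B) :
    mean P (setRound m S) (Sum.elim (cardPotential B φ) g) ≤
      ENNReal.ofReal ((S.card : ℝ) / B.card) * g (4 * S.card ^ 2) +
        ENNReal.ofReal (1 - (S.card : ℝ) / B.card) * φ (S.card + 1) := by
  have hB := hm.nonempty.card_pos
  have hB' : (B.card : ℝ) ≠ 0 := by exact_mod_cast hB.ne'
  have hnew : 1 - (S.card : ℝ) / B.card = ((B \ S).card : ℝ) / B.card := by
    rw [Finset.cast_card_sdiff hS, sub_div, div_self hB']
  rw [setRound, hm.mean_bind_pure, hnew, ← natCast_mul_inv_eq_ofReal hB,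
    ← natCast_mul_inv_eq_ofReal hB]
  refine (hm.mean_le _).trans_eq ?_
  rw [← Finset.sum_sdiff hS, add_comm, mul_assoc, mul_assoc, ← nsmul_eq_mul, ← nsmul_eq_mul,
    ← Finset.sum_const, ← Finset.sum_const]
  congr 1
  · refine Finset.sum_congr rfl fun a ha => ?_
    rw [if_pos ha, Sum.elim_inr]
  · refine Finset.sum_congr rfl fun a ha => ?_
    obtain ⟨haB, haS⟩ := Finset.mem_sdiff.1 ha
    rw [if_neg haS, Sum.elim_inl, cardPotential, if_pos (Finset.insert_subset haB hS),
      Finset.card_insert_of_notMem haS]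

lemma mean_setSizeEstimator_le (hm : Samples P w B (fun _ => (B.card : ℝ≥0∞)⁻¹) m)
    (φ g : ℕ → ℝ≥0∞)
    (hφ : ∀ j ≤ B.card, ENNReal.ofReal ((j : ℝ) / B.card) * g (4 * j ^ 2) +
      ENNReal.ofReal (1 - (j : ℝ) / B.card) * φ (j + 1) ≤ φ j) :
    mean P (setSizeEstimator m) g ≤ φ 0 := by
  rw [setSizeEstimator_eq_loop]
  refine (mean_loop_le hm.toFresh.setRound (Φ := cardPotential B φ)
    (fun S => ?_) ∅).trans_eq (by simp [cardPotential])
  by_cases hS : S ⊆ B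
  · refine (mean_setRound_le hm φ g hS).trans ((hφ _ (Finset.card_le_card hS)).trans_eq ?_)
    rw [cardPotential, if_pos hS]
  · simp [cardPotential, hS]

lemma prob_setSizeEstimator_compl_le (hm : Samples P w B (fun _ => (B.card : ℝ≥0∞)⁻¹) m) :
    prob P (setSizeEstimator m) (Set.Ici B.card)ᶜ ≤ 1 / 3 := by
  refine (mean_setSizeEstimator_le hm (fun j => ENNReal.ofReal (earlyRepeatBound B.card j)) _
    fun j hj => ?_).trans ?_
  · have hind : (Set.Ici B.card)ᶜ.indicator (1 : ℕ → ℝ≥0∞) (4 * j ^ 2) =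
        ENNReal.ofReal (if 4 * j ^ 2 < B.card then 1 else 0) := by
      simp only [Set.compl_Ici, Set.indicator_apply, Set.mem_Iio]
      split_ifs <;> simp
    rw [hind]
    exact ofReal_mul_add_ofReal_mul_le (natCast_div_mem_unitInterval hj) (by positivity)
      (earlyRepeatBound_nonneg _ _) (mul_add_mul_earlyRepeatBound_succ_le _ _)
  · simp [earlyRepeatBound, hm.nonempty.card_pos, ENNReal.ofReal_inv_of_pos]

lemma mean_sqrt_setSizeEstimator_le (hm : Samples P w B (fun _ => (B.card : ℝ≥0∞)⁻¹) m) :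
    mean P (setSizeEstimator m) (fun n => ENNReal.ofReal √(n : ℝ)) ≤
      ENNReal.ofReal (6 * √(B.card : ℝ)) := by
  have hB := hm.nonempty.card_pos
  refine (mean_setSizeEstimator_le hm
    (fun j => ENNReal.ofReal (2 * (j + birthdayBound B.card j))) _ fun j hj => ?_).trans ?_
  · have hsqrt : √((4 * j ^ 2 : ℕ) : ℝ) = 2 * j := by
      rw [Real.sqrt_eq_iff_mul_self_eq (by positivity) (by positivity)]
      push_cast
      ring
    rw [hsqrt]
    have hnonneg := birthdayBound_nonneg B.card (j + 1)
    refine ofReal_mul_add_ofReal_mul_le (natCast_div_mem_unitInterval hj) (by positivity)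
      (by positivity) ?_
    push_cast
    linarith [one_add_mul_birthdayBound_succ_le (j := j) hB,
      (natCast_div_mem_unitInterval hj).1]
  · refine ENNReal.ofReal_le_ofReal ?_
    rw [Nat.cast_zero, zero_add]
    linarith [birthdayBound_zero_le hB]

lemma cost_setSizeEstimator_le (hm : Samples P w B (fun _ => (B.card : ℝ≥0∞)⁻¹) m) :
    cost P (setSizeEstimator m) ≤ cost P m * ENNReal.ofReal (3 * √(B.card : ℝ)) := by
  have hB := hm.nonempty.card_pos
  rw [setSizeEstimator_eq_loop]
  refine (cost_loop_le hm.toFresh.setRound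
    (Φ := cardPotential B fun j => cost P m * ENNReal.ofReal (birthdayBound B.card j))
    (fun S => ?_) ∅).trans ?_
  · by_cases hS : S ⊆ B
    · refine (add_le_add (hm.cost_bind_pure_le _) (mean_setRound_le hm _ _ hS)).trans ?_
      rw [cardPotential, if_pos hS, mul_zero, zero_add]
      calc cost P m + ENNReal.ofReal (1 - (S.card : ℝ) / B.card) *
            (cost P m * ENNReal.ofReal (birthdayBound B.card (S.card + 1)))
          = cost P m * (1 + ENNReal.ofReal (1 - (S.card : ℝ) / B.card) *
              ENNReal.ofReal (birthdayBound B.card (S.card + 1))) := by ring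
        _ ≤ _ := by
          gcongr
          exact one_add_mul_ofReal_birthdayBound_succ_le hB (Finset.card_le_card hS)
    · simp [cardPotential, hS]
  · simp only [cardPotential, Finset.empty_subset, if_true, Finset.card_empty]
    gcongr
    exact birthdayBound_zero_le hB

lemma Proper.setSizeEstimator (hm : Samples P w B (fun _ => (B.card : ℝ≥0∞)⁻¹) m) :
    Proper P (setSizeEstimator m) := by
  rw [setSizeEstimator_eq_loop]
  refine Proper.loop hm.toProper.setRound
    (Φ := cardPotential B fun j => ENNReal.ofReal (birthdayBound B.card j))
    (fun S => ?_) (by simp [cardPotential])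
  by_cases hS : S ⊆ B
  · refine (add_le_add_right (mean_setRound_le hm _ _ hS) _).trans ?_
    rw [cardPotential, if_pos hS, mul_zero, zero_add]
    exact one_add_mul_ofReal_birthdayBound_succ_le hm.nonempty.card_pos (Finset.card_le_card hS)
  · simp [cardPotential, hS]

end SetSize

/-! ### Estimating the probability of a bucket -/

section Bernoulli

/-- A function of (successes, trials) as a potential on the states of `bernoulliEstimator`; the
other states never occur. -/
def trialPotential (k : ℕ) (φ : ℕ → ℕ → ℝ≥0∞) (s : ℕ × ℕ) : ℝ≥0∞ :=
  if s.1 < k then φ s.1 s.2 else ⊤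

/-- A round of `bernoulliEstimator` aiming at `k` successes. -/
def bernoulliRound (m : Prog U Bool) (k : ℕ) (s : ℕ × ℕ) : Prog U (ℕ × ℕ ⊕ ℝ) :=
  m >>= fun x =>
    pure (if (if x then s.1 + 1 else s.1) = k then
      .inr (((if x then s.1 + 1 else s.1 : ℕ) : ℝ) / ((s.2 + 1 : ℕ) : ℝ))
    else .inl ((if x then s.1 + 1 else s.1), s.2 + 1))

lemma bernoulliEstimator_eq_loop (m : Prog U Bool) (δ : ℝ) :
    bernoulliEstimator m δ = loop (bernoulliRound m ⌈12 / δ ^ 2⌉₊) (0, 0) := by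
  unfold bernoulliEstimator bernoulliRound
  congr! 4
  exact (apply_ite pure _ _ _).symm

/-- The trial succeeds with probability `p`. -/
structure TrialWith {mT : MeasurableSpace (Tape U)} (P : Measure (Tape U)) (p : ℝ)
    (m : Prog U Bool) : Prop extends Proper P m where
  pos : 0 < p
  le_one : p ≤ 1
  mean_le (g : Bool → ℝ≥0∞) :
    mean P m g ≤ ENNReal.ofReal p * g true + ENNReal.ofReal (1 - p) * g false

/-- A bound on the expected number of trials until `k` successes, given `s` successes so far. -/
def trialsBound (p : ℝ) (k s : ℕ) : ℝ≥0∞ := ENNReal.ofReal (((k : ℝ) - s) / p)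

/-- If `s` successes occur in the first `t` trials with success probability `p`, then the number
`T` of trials until `k` successes satisfies `E (p * T - k) ^ 2 = squaredDeviation p k s t`. -/
def squaredDeviation (p : ℝ) (k s t : ℕ) : ℝ := (p * t - s) ^ 2 + ((k : ℝ) - s) * (1 - p)

variable {p : ℝ}

lemma one_add_trialsBound_le (hp : 0 < p) (hp' : p ≤ 1) {k s : ℕ} (hs : s < k) :
    1 + (ENNReal.ofReal p * trialsBound p k (s + 1) + ENNReal.ofReal (1 - p) * trialsBound p k s) ≤
      trialsBound p k s := by
  have hk : (s : ℝ) + 1 ≤ k := by exact_mod_cast hs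
  have hsucc : 0 ≤ ((k : ℝ) - (s + 1 : ℕ)) / p := div_nonneg (by push_cast; linarith) hp.le
  have hsame : 0 ≤ ((k : ℝ) - s) / p := div_nonneg (by linarith) hp.le
  refine (add_le_add_right
    (ofReal_mul_add_ofReal_mul_le ⟨hp.le, hp'⟩ hsucc hsame le_rfl) _).trans ?_
  rw [← ENNReal.ofReal_one, ← ENNReal.ofReal_add zero_le_one
    (add_nonneg (mul_nonneg hp.le hsucc) (mul_nonneg (sub_nonneg.2 hp') hsame))]
  refine ENNReal.ofReal_le_ofReal (le_of_eq ?_)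
  push_cast
  field_simp
  ring

lemma squaredDeviation_nonneg (hp : p ≤ 1) {k s : ℕ} (hs : s ≤ k) (t : ℕ) :
    0 ≤ squaredDeviation p k s t :=
  add_nonneg (sq_nonneg _)
    (mul_nonneg (sub_nonneg.2 (by exact_mod_cast hs)) (sub_nonneg.2 hp))

lemma squaredDeviation_eq (p : ℝ) (k s t : ℕ) :
    p * squaredDeviation p k (s + 1) (t + 1) + (1 - p) * squaredDeviation p k s (t + 1) =
      squaredDeviation p k s t := by
  unfold squaredDeviation
  push_cast
  ring

lemma div_mem_Icc_of_abs_sub_lt {x k T : ℝ} (hx : x ∈ Set.Ioo 0 1) (hT : 0 < T)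
    (h : |p * T - k| < k * x) : k / T ∈ Set.Icc (p / (1 + x)) (p / (1 - x)) := by
  obtain ⟨hlo, hhi⟩ := abs_lt.1 h
  obtain ⟨hx₀, hx₁⟩ := hx
  refine ⟨?_, ?_⟩
  · rw [div_le_div_iff₀ (by linarith) hT]
    linarith
  · rw [div_le_div_iff₀ hT (by linarith)]
    linarith

variable {mT : MeasurableSpace (Tape U)} {P : Measure (Tape U)} [IsProbabilityMeasure P]
  {m : Prog U Bool} {k : ℕ}

lemma Fresh.bernoulliRound (hm : Fresh P m) (k : ℕ) (s : ℕ × ℕ) :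
    Fresh P (bernoulliRound m k s) :=
  hm.bind fun _ => Fresh.pure _

lemma Proper.bernoulliRound (hm : Proper P m) (k : ℕ) (s : ℕ × ℕ) :
    Proper P (bernoulliRound m k s) :=
  hm.bind fun _ => Proper.pure _

lemma mean_bernoulliRound_le (hm : TrialWith P p m) {φ : ℕ → ℕ → ℝ≥0∞} {g : ℝ → ℝ≥0∞}
    (hg : ∀ t : ℕ, g ((k : ℝ) / ((t + 1 : ℕ) : ℝ)) ≤ φ k (t + 1)) {s : ℕ × ℕ} (hs : s.1 < k) :
    mean P (bernoulliRound m k s) (Sum.elim (trialPotential k φ) g) ≤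
      ENNReal.ofReal p * φ (s.1 + 1) (s.2 + 1) + ENNReal.ofReal (1 - p) * φ s.1 (s.2 + 1) := by
  rw [PropSampling.bernoulliRound, hm.mean_bind_pure]
  refine (hm.mean_le _).trans ?_
  gcongr
  · rw [if_pos rfl]
    split_ifs with hlast
    · rw [hlast]
      exact hg s.2
    · rw [Sum.elim_inl, trialPotential, if_pos (lt_of_le_of_ne hs hlast)]
  · rw [if_neg Bool.false_ne_true, if_neg hs.ne, Sum.elim_inl, trialPotential, if_pos hs]

lemma mean_bernoulliLoop_le (hm : TrialWith P p m) (hk : 0 < k) {φ : ℕ → ℕ → ℝ≥0∞}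
    {g : ℝ → ℝ≥0∞} (hg : ∀ t : ℕ, g ((k : ℝ) / ((t + 1 : ℕ) : ℝ)) ≤ φ k (t + 1))
    (hφ : ∀ s t, s < k →
      ENNReal.ofReal p * φ (s + 1) (t + 1) + ENNReal.ofReal (1 - p) * φ s (t + 1) ≤ φ s t) :
    mean P (loop (bernoulliRound m k) (0, 0)) g ≤ φ 0 0 := by
  refine (mean_loop_le (hm.toFresh.bernoulliRound k)
    (Φ := trialPotential k φ) (fun s => ?_) (0, 0)).trans_eq (by simp [trialPotential, hk])
  by_cases hs : s.1 < k
  · refine (mean_bernoulliRound_le hm hg hs).trans ((hφ _ _ hs).trans_eq ?_)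
    rw [trialPotential, if_pos hs]
  · simp [trialPotential, hs]

lemma Proper.bernoulliLoop (hm : TrialWith P p m) (hk : 0 < k) :
    Proper P (PropSampling.loop (PropSampling.bernoulliRound m k) (0, 0)) := by
  refine Proper.loop (hm.toProper.bernoulliRound k)
    (Φ := trialPotential k fun s _ => trialsBound p k s) (fun s => ?_)
    (by simp [trialPotential, hk, trialsBound])
  by_cases hs : s.1 < k
  · refine (add_le_add_right (mean_bernoulliRound_le hm (fun _ => zero_le) hs) _).trans ?_
    rw [trialPotential, if_pos hs]
    exact one_add_trialsBound_le hm.pos hm.le_one hs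
  · simp [trialPotential, hs]

lemma cost_bernoulliLoop_le (hm : TrialWith P p m) (hk : 0 < k) :
    cost P (loop (bernoulliRound m k) (0, 0)) ≤ cost P m * ENNReal.ofReal ((k : ℝ) / p) := by
  refine (cost_loop_le (hm.toFresh.bernoulliRound k)
    (Φ := trialPotential k fun s _ => cost P m * trialsBound p k s) (fun s => ?_) (0, 0)).trans_eq
    (by simp [trialPotential, hk, trialsBound])
  by_cases hs : s.1 < k
  · refine (add_le_add (hm.cost_bind_pure_le _)
      (mean_bernoulliRound_le hm (fun _ => zero_le) hs)).trans ?_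
    rw [trialPotential, if_pos hs]
    calc cost P m + (ENNReal.ofReal p * (cost P m * trialsBound p k (s.1 + 1)) +
          ENNReal.ofReal (1 - p) * (cost P m * trialsBound p k s.1))
        = cost P m * (1 + (ENNReal.ofReal p * trialsBound p k (s.1 + 1) +
            ENNReal.ofReal (1 - p) * trialsBound p k s.1)) := by ring
      _ ≤ _ := by
        gcongr
        exact one_add_trialsBound_le hm.pos hm.le_one hs
  · simp [trialPotential, hs]

lemma prob_bernoulliLoop_compl_le (hm : TrialWith P p m) (hk : 0 < k) {x : ℝ}
    (hx : x ∈ Set.Ioo 0 1) :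
    prob P (loop (bernoulliRound m k) (0, 0)) (Set.Icc (p / (1 + x)) (p / (1 - x)))ᶜ ≤
      ENNReal.ofReal ((1 - p) / (k * x ^ 2)) := by
  have hx₀ := hx.1
  refine (mean_bernoulliLoop_le hm hk
    (φ := fun s t => ENNReal.ofReal (squaredDeviation p k s t / (k * x) ^ 2)) (fun t => ?_)
    fun s t hs => ?_).trans_eq ?_
  · by_cases hgood : (k : ℝ) / ((t + 1 : ℕ) : ℝ) ∈ Set.Icc (p / (1 + x)) (p / (1 - x))
    · rw [Set.indicator_of_notMem (Set.notMem_compl_iff.2 hgood)]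
      exact zero_le
    · have hdev := mt (div_mem_Icc_of_abs_sub_lt hx (by positivity)) hgood
      rw [Set.indicator_of_mem hgood, Pi.one_apply, ← ENNReal.ofReal_one]
      refine ENNReal.ofReal_le_ofReal ((one_le_div (by positivity)).2 ?_)
      rw [squaredDeviation, sub_self, zero_mul, add_zero, sq_le_sq, abs_of_pos (by positivity)]
      exact not_lt.1 hdev
  · refine ofReal_mul_add_ofReal_mul_le ⟨hm.pos.le, hm.le_one⟩ ?_ ?_ (le_of_eq ?_)
    · exact div_nonneg (squaredDeviation_nonneg hm.le_one hs _) (by positivity)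
    · exact div_nonneg (squaredDeviation_nonneg hm.le_one hs.le _) (by positivity)
    · rw [← squaredDeviation_eq p k s t]
      ring
  · congr 1
    unfold squaredDeviation
    push_cast
    field_simp
    ring

lemma prob_bernoulliEstimator_compl_le (hm : TrialWith P p m) {δ : ℝ} (hδ : δ ∈ Set.Ioo 0 1) :
    prob P (bernoulliEstimator m δ) (Set.Icc (p / (1 + δ / 2)) (p / (1 - δ / 2)))ᶜ ≤ 1 / 3 := by
  have hδ₀ := hδ.1
  have hk : 0 < ⌈12 / δ ^ 2⌉₊ := Nat.ceil_pos.2 (by positivity)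
  have hle : 12 ≤ (⌈12 / δ ^ 2⌉₊ : ℝ) * δ ^ 2 :=
    (div_le_iff₀ (by positivity)).1 (Nat.le_ceil _)
  have hp := hm.pos
  rw [bernoulliEstimator_eq_loop]
  calc prob P _ (Set.Icc (p / (1 + δ / 2)) (p / (1 - δ / 2)))ᶜ
      ≤ ENNReal.ofReal ((1 - p) / (⌈12 / δ ^ 2⌉₊ * (δ / 2) ^ 2)) :=
        prob_bernoulliLoop_compl_le hm hk ⟨by positivity, by linarith [hδ.2]⟩
    _ ≤ ENNReal.ofReal (1 / 3) := by
        refine ENNReal.ofReal_le_ofReal ?_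
        rw [div_le_div_iff₀ (by positivity) (by norm_num)]
        linarith
    _ = 1 / 3 := by simp [ENNReal.ofReal_inv_of_pos]

lemma Fresh.bernoulliEstimator (hm : Fresh P m) (δ : ℝ) : Fresh P (bernoulliEstimator m δ) := by
  rw [bernoulliEstimator_eq_loop]
  exact Fresh.loop (hm.bernoulliRound _) _

lemma Proper.bernoulliEstimator (hm : TrialWith P p m) {δ : ℝ} (hδ : 0 < δ) :
    Proper P (bernoulliEstimator m δ) := by
  rw [bernoulliEstimator_eq_loop]
  exact Proper.bernoulliLoop hm (Nat.ceil_pos.2 (by positivity))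

lemma cost_bernoulliEstimator_le (hm : TrialWith P p m) {δ : ℝ} (hδ : 0 < δ) :
    cost P (bernoulliEstimator m δ) ≤ cost P m * ENNReal.ofReal ((⌈12 / δ ^ 2⌉₊ : ℝ) / p) := by
  rw [bernoulliEstimator_eq_loop]
  exact cost_bernoulliLoop_le hm (Nat.ceil_pos.2 (by positivity))

end Bernoulli

section BucketTrial

variable [Fintype U] [MeasurableSpace U] [MeasurableSingletonClass U] {w : U → ℝ≥0}
  {hw : 0 < ∑ a, w a} {b : ℤ}

lemma cost_bucketTrial_le (b : ℤ) : cost (tapeLaw w hw) (bucketTrial b) ≤ 1 :=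
  (Proper.draw.cost_bind_pure_le _).trans_eq cost_draw

lemma proper_bucketTrial (b : ℤ) : Proper (tapeLaw w hw) (bucketTrial b) :=
  Proper.draw.bind fun _ => Proper.pure _

lemma trialWith_bucketTrial (hb : (bucket w b).Nonempty) :
    TrialWith (tapeLaw w hw) (bucketProb w b) (bucketTrial b) where
  toProper := proper_bucketTrial b
  pos := by exact_mod_cast bucketProb_pos hb
  le_one := by exact_mod_cast bucketProb_le_one w b
  mean_le g := by
    classical
    have hcompl : ∑ a ∈ (bucket w b)ᶜ, propPMF w hw a = ENNReal.ofReal (1 - bucketProb w b) := by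
      rw [ENNReal.ofReal_sub _ (NNReal.coe_nonneg _), ENNReal.ofReal_one, ENNReal.ofReal_coe_nnreal,
        ← sum_propPMF w hw, ← Finset.sum_add_sum_compl (bucket w b), sum_propPMF_bucket,
        ENNReal.add_sub_cancel_left ENNReal.coe_ne_top]
    rw [bucketTrial, Proper.draw.mean_bind_pure, mean_draw,
      ← Finset.sum_add_sum_compl (bucket w b), ← hcompl, ENNReal.ofReal_coe_nnreal,
      ← sum_propPMF_bucket hw, Finset.sum_mul, Finset.sum_mul]
    refine add_le_add (Finset.sum_le_sum fun a ha => ?_) (Finset.sum_le_sum fun a ha => ?_)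
    · rw [decide_eq_true (mem_bucket.1 ha)]
    · rw [decide_eq_false (mt mem_bucket.2 (Finset.mem_compl.1 ha))]

end BucketTrial

/-! ### Repetitions among independent samples -/

section Repetitions

/-- The expected value of `g` on a list of `n` independent samples from `B`, the item `a` being
chosen with probability `p a`. -/
def listMean (B : Finset U) (p : U → ℝ) : ℕ → (List U → ℝ) → ℝ
  | 0, g => g []
  | n + 1, g => ∑ a ∈ B, p a * listMean B p n fun l => g (a :: l)

variable {B : Finset U} {p v : U → ℝ}

lemma listMean_congr {n : ℕ} {g h : List U → ℝ}
    (hgh : ∀ l, l.length = n → (∀ a ∈ l, a ∈ B) → g l = h l) :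
    listMean B p n g = listMean B p n h := by
  induction n generalizing g h with
  | zero => exact hgh [] rfl (by simp)
  | succ n ih =>
    refine Finset.sum_congr rfl fun a ha => congrArg (p a * ·) (ih fun l hl hlB => ?_)
    exact hgh _ (congrArg (· + 1) hl) (List.forall_mem_cons.2 ⟨ha, hlB⟩)

lemma listMean_nonneg (hp : ∀ a ∈ B, 0 ≤ p a) (n : ℕ) {g : List U → ℝ} (hg : ∀ l, 0 ≤ g l) :
    0 ≤ listMean B p n g := by
  induction n generalizing g with
  | zero => exact hg []
  | succ n ih => exact Finset.sum_nonneg fun a ha => mul_nonneg (hp a ha) (ih fun l => hg _)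

lemma listMean_add (n : ℕ) (g h : List U → ℝ) :
    listMean B p n (fun l => g l + h l) = listMean B p n g + listMean B p n h := by
  induction n generalizing g h with
  | zero => rfl
  | succ n ih => simp only [listMean, ih, mul_add, Finset.sum_add_distrib]

lemma listMean_const_mul (n : ℕ) (c : ℝ) (g : List U → ℝ) :
    listMean B p n (fun l => c * g l) = c * listMean B p n g := by
  induction n generalizing g with
  | zero => rfl
  | succ n ih => simp only [listMean, ih, Finset.mul_sum, mul_left_comm]

lemma listMean_const (hp : ∑ a ∈ B, p a = 1) (n : ℕ) (c : ℝ) :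
    listMean B p n (fun _ => c) = c := by
  induction n with
  | zero => rfl
  | succ n ih => simp only [listMean, ih, ← Finset.sum_mul, hp, one_mul]

lemma listMean_sum {ι : Type} (n : ℕ) (s : Finset ι) (g : ι → List U → ℝ) :
    listMean B p n (fun l => ∑ i ∈ s, g i l) = ∑ i ∈ s, listMean B p n (g i) := by
  induction n generalizing g with
  | zero => rfl
  | succ n ih =>
    simp only [listMean, ih, Finset.mul_sum]
    exact Finset.sum_comm

lemma listMean_succ_eq_listMean_sum (n : ℕ) (g : List U → ℝ) :
    listMean B p (n + 1) g = listMean B p n fun l => ∑ a ∈ B, p a * g (a :: l) := by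
  simp only [listMean_sum, listMean_const_mul]
  rfl

variable [DecidableEq U] {a : U}

lemma sum_mul_count_cons (ha : a ∈ B) (hp : ∑ b ∈ B, p b = 1) (l : List U) (f : ℕ → ℝ) :
    ∑ b ∈ B, p b * f ((b :: l).count a) =
      f (l.count a) + p a * (f (l.count a + 1) - f (l.count a)) := by
  have hterm (b : U) : p b * f ((b :: l).count a) =
      p b * f (l.count a) + if b = a then p b * (f (l.count a + 1) - f (l.count a)) else 0 := by
    by_cases h : b = a
    · simp only [h, List.count_cons_self, if_true]
      ring
    · simp [List.count_cons_of_ne h, h]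
  simp only [hterm, Finset.sum_add_distrib, ← Finset.sum_mul, hp, one_mul, Finset.sum_ite_eq',
    if_pos ha]

lemma listMean_count (ha : a ∈ B) (hp : ∑ b ∈ B, p b = 1) (n : ℕ) :
    listMean B p n (fun l => (l.count a : ℝ)) = n * p a := by
  induction n with
  | zero => simp [listMean]
  | succ n ih =>
    simp only [listMean_succ_eq_listMean_sum, sum_mul_count_cons ha hp _ Nat.cast, Nat.cast_succ,
      add_sub_cancel_left, mul_one, listMean_add, ih, listMean_const hp]
    ring

lemma listMean_count_sq (ha : a ∈ B) (hp : ∑ b ∈ B, p b = 1) (n : ℕ) :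
    listMean B p n (fun l => (l.count a : ℝ) ^ 2) = n * p a * (1 - p a) + n ^ 2 * p a ^ 2 := by
  induction n with
  | zero => simp [listMean]
  | succ n ih =>
    have hincrement (l : List U) : p a * (((l.count a + 1 : ℕ) : ℝ) ^ 2 - (l.count a : ℝ) ^ 2) =
        2 * p a * (l.count a : ℝ) + p a := by
      push_cast
      ring
    rw [listMean_succ_eq_listMean_sum]
    simp only [sum_mul_count_cons ha hp _ fun k => (k : ℝ) ^ 2, hincrement, listMean_add,
      listMean_const_mul, listMean_count ha hp, listMean_const hp, ih]
    push_cast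
    ring

/-- The number of repeated pairs, each weighted by the inverse of the weight of its item. -/
def pairSum (B : Finset U) (v : U → ℝ) (l : List U) : ℝ :=
  ∑ a ∈ B, ((l.count a).choose 2 : ℝ) / v a

lemma pairSum_cons (ha : a ∈ B) (l : List U) :
    pairSum B v (a :: l) = pairSum B v l + (l.count a : ℝ) / v a := by
  have hterm (b : U) : (((a :: l).count b).choose 2 : ℝ) / v b =
      ((l.count b).choose 2 : ℝ) / v b + if b = a then (l.count b : ℝ) / v b else 0 := by
    by_cases h : b = a
    · simp only [h, List.count_cons_self, if_true, Nat.choose_succ_succ' _ 1, Nat.choose_one_right]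
      push_cast
      ring
    · simp [List.count_cons_of_ne (Ne.symm h), h]
  simp only [pairSum, hterm, Finset.sum_add_distrib, Finset.sum_ite_eq', if_pos ha]

/-- The deviation of the weighted number of repeated pairs from its mean under proportional
sampling. -/
def pairDeviation (B : Finset U) (v : U → ℝ) (l : List U) : ℝ :=
  pairSum B v l - (l.length.choose 2 : ℝ) / ∑ a ∈ B, v a

lemma pairDeviation_cons (ha : a ∈ B) (l : List U) :
    pairDeviation B v (a :: l) = pairDeviation B v l +
      ((l.count a : ℝ) / v a - (l.length : ℝ) / ∑ a ∈ B, v a) := by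
  rw [pairDeviation, pairDeviation, pairSum_cons ha, List.length_cons, Nat.choose_succ_succ' _ 1,
    Nat.choose_one_right]
  push_cast
  ring

lemma sum_count_eq_length {l : List U} (hl : ∀ a ∈ l, a ∈ B) :
    ∑ a ∈ B, (l.count a : ℝ) = l.length := by
  have h := Multiset.sum_count_eq_card (s := B) (m := (l : Multiset U)) fun a ha => hl a ha
  simp only [Multiset.coe_count, Multiset.coe_card] at h
  exact_mod_cast h

/-- The increment of the deviation caused by a new proportional sample has mean zero, so that no
cross term appears. -/
lemma sum_mul_pairDeviation_cons_sq (hB : B.Nonempty) (hv : ∀ a ∈ B, 0 < v a) {l : List U}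
    (hl : ∀ a ∈ l, a ∈ B) :
    ∑ a ∈ B, v a / (∑ x ∈ B, v x) * pairDeviation B v (a :: l) ^ 2 =
      pairDeviation B v l ^ 2 + (∑ a ∈ B, (l.count a : ℝ) ^ 2 / ((∑ x ∈ B, v x) * v a) +
        -((l.length : ℝ) / ∑ x ∈ B, v x) ^ 2) := by
  set V := ∑ x ∈ B, v x with hV
  have hV₀ : 0 < V := Finset.sum_pos hv hB
  have hterm : ∀ a ∈ B, v a / V * pairDeviation B v (a :: l) ^ 2 =
      v a * ((pairDeviation B v l - l.length / V) ^ 2 / V) +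
        (l.count a : ℝ) * (2 * (pairDeviation B v l - l.length / V) / V) +
        (l.count a : ℝ) ^ 2 / (V * v a) := fun a ha => by
    have := (hv a ha).ne'
    rw [pairDeviation_cons ha, ← hV]
    field_simp
    ring
  rw [Finset.sum_congr rfl hterm, Finset.sum_add_distrib, Finset.sum_add_distrib,
    ← Finset.sum_mul, ← hV, ← Finset.sum_mul, sum_count_eq_length hl]
  field_simp
  ring

lemma listMean_sum_count_sq_div (hB : B.Nonempty) (hv : ∀ a ∈ B, 0 < v a) (n : ℕ) :
    listMean B (fun a => v a / ∑ x ∈ B, v x) n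
        (fun l => ∑ a ∈ B, (l.count a : ℝ) ^ 2 / ((∑ x ∈ B, v x) * v a)) =
      (n * B.card + (n ^ 2 - n)) / (∑ x ∈ B, v x) ^ 2 := by
  set V := ∑ x ∈ B, v x with hV
  have hV₀ : 0 < V := Finset.sum_pos hv hB
  have hp : ∑ a ∈ B, v a / V = 1 := by rw [← Finset.sum_div, ← hV, div_self hV₀.ne']
  have hterm : ∀ a ∈ B, listMean B (fun a => v a / V) n
      (fun l => (l.count a : ℝ) ^ 2 / (V * v a)) =
        n / V ^ 2 + v a / V * ((n ^ 2 - n) / V ^ 2) := fun a ha => by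
    have := (hv a ha).ne'
    simp only [div_eq_inv_mul ((List.count a _ : ℝ) ^ 2)]
    rw [listMean_const_mul, listMean_count_sq ha hp]
    field_simp
    ring
  rw [listMean_sum, Finset.sum_congr rfl hterm, Finset.sum_add_distrib, ← Finset.sum_mul, hp,
    Finset.sum_const, nsmul_eq_mul]
  ring

lemma listMean_pairDeviation_sq (hB : B.Nonempty) (hv : ∀ a ∈ B, 0 < v a) (n : ℕ) :
    listMean B (fun a => v a / ∑ x ∈ B, v x) n (fun l => pairDeviation B v l ^ 2) =
      (n.choose 2 : ℝ) * (B.card - 1) / (∑ a ∈ B, v a) ^ 2 := by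
  have hp : ∑ a ∈ B, v a / ∑ x ∈ B, v x = 1 := by
    rw [← Finset.sum_div, div_self (Finset.sum_pos hv hB).ne']
  induction n with
  | zero => simp [listMean, pairDeviation, pairSum]
  | succ n ih =>
    rw [listMean_succ_eq_listMean_sum, listMean_congr fun l hl hlB => by
        rw [sum_mul_pairDeviation_cons_sq hB hv hlB, hl], listMean_add, ih, listMean_add,
      listMean_sum_count_sq_div hB hv, listMean_const hp, Nat.choose_succ_succ' n 1,
      Nat.choose_one_right]
    push_cast
    ring

end Repetitions

/-! ### Estimating the weight of a bucket -/

section PropEstimator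

variable {mT : MeasurableSpace (Tape U)} {P : Measure (Tape U)}
  [IsProbabilityMeasure P] {w : U → ℝ≥0} {B : Finset U} {m : Prog U (U × ℝ)}

lemma mean_replicate_le_listMean {p : U → ℝ≥0} (hm : Samples P w B (fun a => (p a : ℝ≥0∞)) m)
    (n : ℕ) {F : List (U × ℝ) → ℝ≥0∞} {f : List U → ℝ} (hf : ∀ l, 0 ≤ f l)
    (hF : ∀ l : List U, l.length = n → (∀ a ∈ l, a ∈ B) →
      F (l.map fun a => (a, (w a : ℝ))) ≤ ENNReal.ofReal (f l)) :
    mean P (replicate n m) F ≤ ENNReal.ofReal (listMean B (fun a => (p a : ℝ)) n f) := by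
  induction n generalizing F f with
  | zero => simpa [replicate, mean_pure, listMean] using hF [] rfl (by simp)
  | succ n ih =>
    have hnonneg (a : U) : 0 ≤ (p a : ℝ) * listMean B (fun a => (p a : ℝ)) n fun l => f (a :: l) :=
      mul_nonneg (p a).coe_nonneg (listMean_nonneg (fun a _ => (p a).coe_nonneg) n fun l => hf _)
    rw [hm.mean_replicate_succ, listMean, ENNReal.ofReal_sum_of_nonneg fun a _ => hnonneg a]
    refine (hm.mean_le _).trans (Finset.sum_le_sum fun a ha => ?_)
    rw [ENNReal.ofReal_mul (p a).coe_nonneg, ENNReal.ofReal_coe_nnreal]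
    gcongr
    refine ih (fun l => hf _) fun l hl hlB => ?_
    exact hF (a :: l) (congrArg (· + 1) hl) (List.forall_mem_cons.2 ⟨ha, hlB⟩)

variable [DecidableEq U]

lemma countP_map_eq_count (w : U → ℝ≥0) (l : List U) (b : U) :
    (l.map fun a => (a, (w a : ℝ))).countP (fun x => x.1 = b) = l.count b := by
  rw [List.countP_map, List.count]
  exact List.countP_congr fun a _ => by simp

lemma pairEstimate_map (hB : ∀ a ∈ B, 0 < w a) {l : List U} (hl : ∀ a ∈ l, a ∈ B) :
    pairEstimate (l.map fun a => (a, (w a : ℝ))) =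
      (l.length.choose 2 : ℝ≥0∞) * (ENNReal.ofReal (pairSum B (fun a => (w a : ℝ)) l))⁻¹ := by
  have hinj : Function.Injective fun a : U => (a, (w a : ℝ)) := fun _ _ h => congrArg Prod.fst h
  have himage : (l.map fun a => (a, (w a : ℝ))).toFinset = l.toFinset.map ⟨_, hinj⟩ := by
    ext x
    simp
  have hsub : l.toFinset ⊆ B := fun a ha => hl a (List.mem_toFinset.1 ha)
  rw [pairEstimate, List.length_map, himage, Finset.sum_map, pairSum,
    ENNReal.ofReal_sum_of_nonneg fun a _ => by positivity]
  simp only [Function.Embedding.coeFn_mk, countP_map_eq_count]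
  rw [Finset.sum_subset hsub fun a _ ha => by
    simp [List.count_eq_zero_of_not_mem (mt List.mem_toFinset.2 ha)]]
  congr! 3 with a ha
  rw [ENNReal.ofReal_div_of_pos (by exact_mod_cast hB a ha), ENNReal.ofReal_natCast]

lemma ofReal_mul_inv_mem_Icc_of_abs_sub_lt {V X C x : ℝ} (hx : x ∈ Set.Ioo 0 1) (hV : 0 < V)
    (hC : 0 < C) (h : |V * X - C| < C * x) :
    ENNReal.ofReal C * (ENNReal.ofReal X)⁻¹ ∈
      Set.Icc (ENNReal.ofReal (V / (1 + x))) (ENNReal.ofReal (V / (1 - x))) := by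
  have hX : 0 < X := by
    refine pos_of_mul_pos_right ?_ hV.le
    nlinarith [(abs_lt.1 h).1, mul_pos hC (sub_pos.2 hx.2)]
  have hmem := div_mem_Icc_of_abs_sub_lt hx hX h
  rw [← ENNReal.ofReal_inv_of_pos hX, ← ENNReal.ofReal_mul hC.le, ← div_eq_mul_inv]
  exact ⟨ENNReal.ofReal_le_ofReal hmem.1, ENNReal.ofReal_le_ofReal hmem.2⟩

/-- Chebyshev's inequality for the weighted number of repeated pairs. -/
lemma prob_pairEstimate_compl_le
    (hm : Samples P w B (fun a => ((w a / ∑ x ∈ B, w x : ℝ≥0) : ℝ≥0∞)) m)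
    (hB : ∀ a ∈ B, 0 < w a) {n : ℕ} (hn : 2 ≤ n) {x : ℝ} (hx : x ∈ Set.Ioo 0 1) :
    prob P (replicate n m >>= fun l => pure (pairEstimate l))
        (Set.Icc (ENNReal.ofReal ((∑ a ∈ B, (w a : ℝ)) / (1 + x)))
          (ENNReal.ofReal ((∑ a ∈ B, (w a : ℝ)) / (1 - x))))ᶜ ≤
      ENNReal.ofReal ((B.card - 1) / (n.choose 2 * x ^ 2)) := by
  set V := ∑ a ∈ B, (w a : ℝ) with hV
  have hx₀ := hx.1
  have hv : ∀ a ∈ B, (0 : ℝ) < w a := fun a ha => by exact_mod_cast hB a ha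
  have hV₀ : 0 < V := Finset.sum_pos hv hm.nonempty
  have hC : (0 : ℝ) < n.choose 2 := by exact_mod_cast Nat.choose_pos hn
  rw [prob, (hm.toFresh.replicate n).mean_bind_pure]
  refine (mean_replicate_le_listMean hm n
    (f := fun l => (V / (n.choose 2 * x)) ^ 2 * pairDeviation B (fun a => (w a : ℝ)) l ^ 2)
    (fun l => by positivity) fun l hl hlB => ?_).trans_eq ?_
  · rw [pairEstimate_map hB hlB, hl, ← ENNReal.ofReal_natCast]
    refine Set.indicator_apply_le' (fun hbad => ?_) fun _ => zero_le
    have hdev : n.choose 2 * x ≤ |V * pairDeviation B (fun a => (w a : ℝ)) l| := by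
      rw [pairDeviation, ← hV, hl, mul_sub, mul_div_cancel₀ _ hV₀.ne', ← not_lt]
      exact mt (ofReal_mul_inv_mem_Icc_of_abs_sub_lt hx hV₀ hC) hbad
    rw [Pi.one_apply, ← ENNReal.ofReal_one, ← mul_pow, div_mul_eq_mul_div, div_pow]
    refine ENNReal.ofReal_le_ofReal ((one_le_div (by positivity)).2 ?_)
    rw [sq_le_sq, abs_of_pos (by positivity)]
    exact hdev
  · have hpush : (fun a => ((w a / ∑ x ∈ B, w x : ℝ≥0) : ℝ)) =
        fun a => (w a : ℝ) / ∑ x ∈ B, (w x : ℝ) := by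
      ext a
      push_cast
      rfl
    rw [hpush, listMean_const_mul, listMean_pairDeviation_sq hm.nonempty hv, ← hV]
    congr 1
    field_simp

lemma twelve_mul_le_choose_mul_sq {N δ : ℝ} (hN : 0 ≤ N) (hδ : 0 < δ) :
    12 * N ≤ ((⌈√(24 * N) / δ⌉₊ + 1).choose 2 : ℝ) * δ ^ 2 := by
  have hceil : √(24 * N) ≤ ⌈√(24 * N) / δ⌉₊ * δ := (div_le_iff₀ hδ).1 (Nat.le_ceil _)
  have hsq : 24 * N ≤ (⌈√(24 * N) / δ⌉₊ * δ) ^ 2 := by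
    calc 24 * N = √(24 * N) ^ 2 := (Real.sq_sqrt (by positivity)).symm
      _ ≤ _ := by gcongr
  rw [Nat.cast_choose_two]
  push_cast
  nlinarith [mul_nonneg (Nat.cast_nonneg (α := ℝ) ⌈√(24 * N) / δ⌉₊) (sq_nonneg δ)]

lemma prob_propEstimator_compl_le
    (hm : Samples P w B (fun a => ((w a / ∑ x ∈ B, w x : ℝ≥0) : ℝ≥0∞)) m)
    (hB : ∀ a ∈ B, 0 < w a) {N δ : ℝ} (hN : B.card ≤ N) (hδ : δ ∈ Set.Ioo 0 1) :
    prob P (propEstimator m N δ)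
        (Set.Icc (ENNReal.ofReal ((∑ a ∈ B, (w a : ℝ)) / (1 + δ / 2)))
          (ENNReal.ofReal ((∑ a ∈ B, (w a : ℝ)) / (1 - δ / 2))))ᶜ ≤ 1 / 3 := by
  have hδ₀ := hδ.1
  have hcard : (1 : ℝ) ≤ B.card := by exact_mod_cast hm.nonempty.card_pos
  have hN₀ : 0 < N := by linarith
  have hn : 2 ≤ ⌈√(24 * N) / δ⌉₊ + 1 := Nat.succ_le_succ (Nat.ceil_pos.2 (by positivity))
  have hchoose := twelve_mul_le_choose_mul_sq hN₀.le hδ₀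
  refine (prob_pairEstimate_compl_le hm hB hn ⟨by positivity, by linarith [hδ.2]⟩).trans ?_
  calc ENNReal.ofReal ((B.card - 1) / ((⌈√(24 * N) / δ⌉₊ + 1).choose 2 * (δ / 2) ^ 2))
      ≤ ENNReal.ofReal (1 / 3) := by
        refine ENNReal.ofReal_le_ofReal (div_le_of_le_mul₀ (by positivity) (by norm_num) ?_)
        linarith
    _ = 1 / 3 := by simp [ENNReal.ofReal_inv_of_pos]

lemma Fresh.propEstimator (hm : Fresh P m) (N δ : ℝ) : Fresh P (propEstimator m N δ) :=
  (hm.replicate _).bind fun _ => Fresh.pure _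

lemma Proper.propEstimator (hm : Proper P m) (N δ : ℝ) : Proper P (propEstimator m N δ) :=
  (hm.replicate _).bind fun _ => Proper.pure _

lemma Fresh.cost_propEstimator_le (hm : Fresh P m) (N : ℝ) {δ : ℝ} (hδ : 0 < δ) :
    cost P (PropSampling.propEstimator m N δ) ≤ ENNReal.ofReal (5 / δ * √N + 2) * cost P m := by
  refine ((hm.replicate _).cost_bind_pure_le _).trans ((hm.cost_replicate_le _).trans ?_)
  gcongr
  rw [← ENNReal.ofReal_natCast]
  refine ENNReal.ofReal_le_ofReal ?_
  have hceil := Nat.ceil_lt_add_one (by positivity : 0 ≤ √(24 * N) / δ)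
  have hsqrt : √(24 * N) ≤ 5 * √N := by
    rw [Real.sqrt_mul (by norm_num)]
    gcongr
    exact Real.sqrt_le_iff.2 (by norm_num)
  have hdiv : √(24 * N) / δ ≤ 5 / δ * √N := by
    rw [div_mul_eq_mul_div]
    gcongr
  push_cast
  linarith

end PropEstimator

/-! ### The estimator for a given bucket -/

section TapeLaw

variable {mT : MeasurableSpace (Tape U)} {P : Measure (Tape U)}

lemma Proper.prob_add_prob_compl {m : Prog U α} (hm : Proper P m) (s : Set α) :
    prob P m s + prob P m sᶜ = 1 := by
  rw [prob, prob, ← hm.mean_add, ← hm.mean_one]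
  congr 1
  exact Set.indicator_self_add_compl s (1 : α → ℝ≥0∞)

variable [IsProbabilityMeasure P]

lemma Fresh.prob_bind_compl_le {m : Prog U α} {f : α → Prog U β} (hm : Fresh P m)
    (hf : ∀ a, Fresh P (f a)) {s : Set β} {t : Set α} {r : ℝ≥0∞}
    (h : ∀ a ∈ t, prob P (f a) sᶜ ≤ r) : prob P (m >>= f) sᶜ ≤ prob P m tᶜ + r := by
  have hstep (a : α) : prob P (f a) sᶜ ≤ tᶜ.indicator 1 a + r := by
    by_cases ha : a ∈ t
    · exact le_add_left (h a ha)
    · rw [Set.indicator_of_mem (Set.mem_compl ha)]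
      exact le_add_right (prob_le_one _ _)
  calc prob P (m >>= f) sᶜ = mean P m fun a => prob P (f a) sᶜ := hm.mean_bind hf _
    _ ≤ prob P m tᶜ + mean P m fun _ => r := (mean_mono hstep).trans_eq (hm.mean_add _ _)
    _ ≤ prob P m tᶜ + r := by gcongr; exact hm.mean_const_le r

end TapeLaw

lemma div_mem_Icc_one_sub_one_add {d v W y r : ℝ} (hd : d ∈ Set.Ioo 0 (1 / 6)) (hv : 0 < v)
    (hW : 0 < W) (hy : y ∈ Set.Icc (v / (1 + d)) (v / (1 - d)))
    (hr : r ∈ Set.Icc (v / W / (1 + d)) (v / W / (1 - d))) :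
    y / r ∈ Set.Icc ((1 - 6 * d) * W) ((1 + 6 * d) * W) := by
  obtain ⟨hd0, hd1⟩ := hd
  have hsub : 0 < 1 - d := by linarith
  have hr0 : 0 < r := lt_of_lt_of_le (by positivity) hr.1
  constructor
  · calc (1 - 6 * d) * W ≤ (1 - d) / (1 + d) * W := by
          gcongr
          rw [le_div_iff₀ (by positivity)]
          nlinarith
      _ = v / (1 + d) / (v / W / (1 - d)) := by field_simp
      _ ≤ y / r := div_le_div₀ (le_trans (by positivity) hy.1) hy.1 hr0 hr.2
  · calc y / r ≤ v / (1 - d) / (v / W / (1 + d)) :=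
          div_le_div₀ (by positivity) hy.2 (by positivity) hr.1
      _ = (1 + d) / (1 - d) * W := by field_simp
      _ ≤ (1 + 6 * d) * W := by
          gcongr
          rw [div_le_iff₀ hsub]
          nlinarith

lemma div_ofReal_mem_Icc_one_sub_one_add {d v W r : ℝ} {x : ℝ≥0∞} (hd : d ∈ Set.Ioo 0 (1 / 6))
    (hv : 0 < v) (hW : 0 < W)
    (hx : x ∈ Set.Icc (ENNReal.ofReal (v / (1 + d))) (ENNReal.ofReal (v / (1 - d))))
    (hr : r ∈ Set.Icc (v / W / (1 + d)) (v / W / (1 - d))) :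
    x / ENNReal.ofReal r ∈
      Set.Icc (ENNReal.ofReal ((1 - 6 * d) * W)) (ENNReal.ofReal ((1 + 6 * d) * W)) := by
  have hr0 : 0 < r := by
    have := hd.1
    exact lt_of_lt_of_le (by positivity) hr.1
  have hsub : 0 < 1 - d := by linarith [hd.2]
  have hfin : x ≠ ∞ := ne_top_of_le_ne_top ENNReal.ofReal_ne_top hx.2
  have hy : x.toReal ∈ Set.Icc (v / (1 + d)) (v / (1 - d)) :=
    ⟨(ENNReal.ofReal_le_iff_le_toReal hfin).1 hx.1,
      ENNReal.toReal_le_of_le_ofReal (by positivity) hx.2⟩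
  obtain ⟨hlow, hhigh⟩ := div_mem_Icc_one_sub_one_add hd hv hW hy hr
  rw [← ENNReal.ofReal_toReal hfin, ← ENNReal.ofReal_div_of_pos hr0]
  exact ⟨ENNReal.ofReal_le_ofReal hlow, ENNReal.ofReal_le_ofReal hhigh⟩

section BucketEstimator

variable [DecidableEq U]

/-- The part of the algorithm that follows the choice of the bucket. -/
def bucketEstimator (ε : ℝ) (b : ℤ) : Prog U ℝ≥0∞ := do
  let nb ← amplify (setSizeEstimator (unifBucketSampler b))
  let Wb ← amplify (propEstimator (propBucketSampler b) nb (ε / 3))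
  let Pb ← amplify (bernoulliEstimator (bucketTrial b) (ε / 3))
  pure (Wb / ENNReal.ofReal Pb)

variable [Fintype U] [MeasurableSpace U] [MeasurableSingletonClass U]
  {w : U → ℝ≥0} {hw : 0 < ∑ a, w a}

lemma Fresh.bucketEstimator (ε : ℝ) (b : ℤ) :
    Fresh (tapeLaw w hw) (bucketEstimator ε b) :=
  ((fresh_unifBucketSampler b).setSizeEstimator.amplify).bind fun _ =>
    ((fresh_propBucketSampler b).propEstimator _ _).amplify.bind fun _ =>
      ((proper_bucketTrial b).toFresh.bernoulliEstimator _).amplify.bind fun _ => Fresh.pure _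

lemma Proper.bucketEstimator {ε : ℝ} (hε : 0 < ε) {b : ℤ} (hb : (bucket w b).Nonempty) :
    Proper (tapeLaw w hw) (bucketEstimator ε b) :=
  (Proper.setSizeEstimator (samples_unifBucketSampler hb)).amplify.bind fun _ =>
    ((samples_propBucketSampler hb).toProper.propEstimator _ _).amplify.bind fun _ =>
      (Proper.bernoulliEstimator (trialWith_bucketTrial hb) (by positivity)).amplify.bind
        fun _ => Proper.pure _

lemma prob_bucketEstimator_compl_le {ε : ℝ} (hε : ε ∈ Set.Ioo 0 1) {b : ℤ}
    (hb : (bucket w b).Nonempty) :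
    prob (tapeLaw w hw) (bucketEstimator ε b)
      (Set.Icc (ENNReal.ofReal ((1 - ε) * (∑ a, w a : ℝ≥0)))
        (ENNReal.ofReal ((1 + ε) * (∑ a, w a : ℝ≥0))))ᶜ ≤ 1 / 10 + (1 / 10 + (1 / 10 + 0)) := by
  have hδ : ε / 3 ∈ Set.Ioo 0 1 := ⟨by linarith [hε.1], by linarith [hε.2]⟩
  have hd : ε / 3 / 2 ∈ Set.Ioo 0 (1 / 6) := ⟨by linarith [hε.1], by linarith [hε.2]⟩
  have hd6 : 6 * (ε / 3 / 2) = ε := by ring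
  have hsum : ∑ a ∈ bucket w b, (w a : ℝ) = bucketWeight w b := (NNReal.coe_sum _ _).symm
  have hfSize := (fresh_unifBucketSampler (hw := hw) b).setSizeEstimator
  have hfWeight (nb : ℕ) := (fresh_propBucketSampler (hw := hw) b).propEstimator nb (ε / 3)
  have hfProb := (proper_bucketTrial (hw := hw) b).toFresh.bernoulliEstimator (ε / 3)
  have hsize := hfSize.prob_amplify_compl_le Set.ordConnected_Ici
    (prob_setSizeEstimator_compl_le (samples_unifBucketSampler hb))
  refine (hfSize.amplify.prob_bind_compl_le (t := Set.Ici (bucket w b).card)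
    (fun nb => (hfWeight nb).amplify.bind fun _ => hfProb.amplify.bind fun _ => Fresh.pure _)
    fun nb hnb => ?_).trans (add_le_add_left hsize _)
  have hweight := (hfWeight nb).prob_amplify_compl_le Set.ordConnected_Icc
    (prob_propEstimator_compl_le (samples_propBucketSampler hb)
      (fun _ => weight_pos_of_mem_bucket) (by exact_mod_cast hnb) hδ)
  refine ((hfWeight nb).amplify.prob_bind_compl_le
    (fun _ => hfProb.amplify.bind fun _ => Fresh.pure _) fun Wb hWb => ?_).trans
    (add_le_add_left hweight _)
  have hprob := hfProb.prob_amplify_compl_le Set.ordConnected_Icc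
    (prob_bernoulliEstimator_compl_le (trialWith_bucketTrial hb) hδ)
  refine (hfProb.amplify.prob_bind_compl_le (fun _ => Fresh.pure _) fun Pb hPb => ?_).trans
    (add_le_add_left hprob _)
  rw [prob, mean_pure, Set.indicator_of_notMem]
  rw [Set.notMem_compl_iff]
  rw [hsum] at hWb
  have h := div_ofReal_mem_Icc_one_sub_one_add hd (by exact_mod_cast bucketWeight_pos hb)
    (by exact_mod_cast hw) hWb hPb
  rwa [hd6] at h

end BucketEstimator

/-! ### The choice of the bucket -/

section Level

/-- The dyadic level of a weight, which is the index of its bucket. -/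
def level (x : ℝ) : ℤ := ⌊Real.logb 2 x⌋

lemma level_eq_iff {x : ℝ} (hx : 0 < x) {b : ℤ} :
    level x = b ↔ x ∈ Set.Ico ((2 : ℝ) ^ b) (2 ^ (b + 1)) := by
  rw [level, Int.floor_eq_iff, Real.le_logb_iff_rpow_le one_lt_two hx,
    Real.logb_lt_iff_lt_rpow one_lt_two hx, Set.mem_Ico, ← Int.cast_one (R := ℝ), ← Int.cast_add,
    Real.rpow_intCast, Real.rpow_intCast]

lemma mem_Ico_zpow_level {x : ℝ} (hx : 0 < x) :
    x ∈ Set.Ico ((2 : ℝ) ^ level x) (2 ^ (level x + 1)) :=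
  (level_eq_iff hx).1 rfl

lemma noAdvicePropEstimator_eq [DecidableEq U] (ε : ℝ) :
    (noAdvicePropEstimator ε : Prog U ℝ≥0∞) =
      draw >>= fun x => draw >>= fun y => bucketEstimator ε (max (level x.2) (level y.2)) := rfl

variable [Fintype U] {w : U → ℝ≥0} {hw : 0 < ∑ a, w a}

lemma mem_bucket_iff_level {a : U} {b : ℤ} : a ∈ bucket w b ↔ 0 < w a ∧ level (w a) = b :=
  ⟨fun h => have hpos := weight_pos_of_mem_bucket h
    ⟨hpos, (level_eq_iff (by exact_mod_cast hpos)).2 (mem_bucket.1 h)⟩,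
    fun h => mem_bucket.2 ((level_eq_iff (by exact_mod_cast h.1)).1 h.2)⟩

lemma bucket_max_level_nonempty {a a' : U} (ha : 0 < w a) (ha' : 0 < w a') :
    (bucket w (max (level (w a)) (level (w a')))).Nonempty := by
  rcases max_choice (level (w a)) (level (w a')) with h | h
  exacts [⟨a, mem_bucket_iff_level.2 ⟨ha, h.symm⟩⟩, ⟨a', mem_bucket_iff_level.2 ⟨ha', h.symm⟩⟩]

variable [MeasurableSpace U] [MeasurableSingletonClass U]

lemma mean_draw_mono {g h : U × ℝ → ℝ≥0∞} (hgh : ∀ a, 0 < w a → g (a, w a) ≤ h (a, w a)) :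
    mean (tapeLaw w hw) draw g ≤ mean (tapeLaw w hw) draw h := by
  rw [mean_draw, mean_draw]
  refine Finset.sum_le_sum fun a _ => ?_
  rcases eq_zero_or_pos (w a) with h0 | h0
  · simp [propPMF_apply, h0]
  · exact mul_le_mul_right (hgh a h0) _

variable [DecidableEq U]

lemma mean_noAdvicePropEstimator (ε : ℝ) (g : ℝ≥0∞ → ℝ≥0∞) :
    mean (tapeLaw w hw) (noAdvicePropEstimator ε) g =
      mean (tapeLaw w hw) draw fun x => mean (tapeLaw w hw) draw fun y =>
        mean (tapeLaw w hw) (bucketEstimator ε (max (level x.2) (level y.2))) g := by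
  have hdraw := (Proper.draw (hw := hw)).toFresh
  rw [noAdvicePropEstimator_eq,
    hdraw.mean_bind fun _ => hdraw.bind fun _ => Fresh.bucketEstimator _ _]
  simp only [hdraw.mean_bind fun _ => Fresh.bucketEstimator _ _]

lemma Proper.noAdvicePropEstimator {ε : ℝ} (hε : 0 < ε) :
    Proper (tapeLaw w hw) (noAdvicePropEstimator ε) where
  toFresh := Proper.draw.toFresh.bind fun _ => Proper.draw.toFresh.bind fun _ =>
    Fresh.bucketEstimator _ _
  mean_one := by
    refine le_antisymm (mean_one_le _) ?_
    rw [mean_noAdvicePropEstimator]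
    calc (1 : ℝ≥0∞)
        = mean (tapeLaw w hw) PropSampling.draw fun _ =>
            mean (tapeLaw w hw) PropSampling.draw fun _ => 1 := by
          simp only [Proper.draw.mean_const]
      _ ≤ _ := mean_draw_mono fun a ha => mean_draw_mono fun a' ha' =>
          (Proper.bucketEstimator hε (bucket_max_level_nonempty ha ha')).mean_one.ge

lemma prob_noAdvicePropEstimator_compl_le {ε : ℝ} (hε : ε ∈ Set.Ioo 0 1) :
    prob (tapeLaw w hw) (noAdvicePropEstimator ε)
      (Set.Icc (ENNReal.ofReal ((1 - ε) * (∑ a, w a : ℝ≥0)))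
        (ENNReal.ofReal ((1 + ε) * (∑ a, w a : ℝ≥0))))ᶜ ≤ 1 / 10 + (1 / 10 + (1 / 10 + 0)) := by
  rw [prob, mean_noAdvicePropEstimator]
  calc _ ≤ mean (tapeLaw w hw) draw fun _ => mean (tapeLaw w hw) draw fun _ =>
        (1 / 10 + (1 / 10 + (1 / 10 + 0)) : ℝ≥0∞) :=
        mean_draw_mono fun a ha => mean_draw_mono fun a' ha' =>
          prob_bucketEstimator_compl_le hε (bucket_max_level_nonempty ha ha')
    _ = _ := by simp only [Proper.draw.mean_const]

lemma two_thirds_le_prob_noAdvicePropEstimator {ε : ℝ} (hε : ε ∈ Set.Ioo 0 1) :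
    2 / 3 ≤ prob (tapeLaw w hw) (noAdvicePropEstimator ε)
      (Set.Icc (ENNReal.ofReal ((1 - ε) * (∑ a, w a : ℝ≥0)))
        (ENNReal.ofReal ((1 + ε) * (∑ a, w a : ℝ≥0)))) := by
  have htenth : (1 / 10 + (1 / 10 + (1 / 10 + 0)) : ℝ≥0∞) ≤ 1 / 3 := by
    have h : ((1 / 10 + (1 / 10 + (1 / 10 + 0)) : ℝ≥0) : ℝ≥0∞) ≤ ((1 / 3 : ℝ≥0) : ℝ≥0∞) :=
      ENNReal.coe_le_coe.2 (NNReal.coe_le_coe.1 (by norm_num))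
    simpa using h
  have hthird : (2 / 3 + 1 / 3 : ℝ≥0∞) = 1 := by
    rw [ENNReal.div_add_div_same, two_add_one_eq_three]
    exact ENNReal.div_self (by norm_num) (by norm_num)
  refine (ENNReal.add_le_add_iff_right (a := 1 / 3) (by norm_num)).1 ?_
  calc (2 / 3 + 1 / 3 : ℝ≥0∞) = _ := hthird.trans
        ((Proper.noAdvicePropEstimator (hw := hw) hε.1).prob_add_prob_compl _).symm
    _ ≤ _ := add_le_add_right ((prob_noAdvicePropEstimator_compl_le hε).trans htenth) _

end Level

/-! ### Executions on a weighted universe -/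

section Execution

variable [Fintype U] [MeasurableSpace U] {w : U → ℝ≥0} {hw : 0 < ∑ a, w a}

lemma Fresh.expect_tapeLaw {m : Prog U α} (hm : Fresh (tapeLaw w hw) m) (G : α → ℕ → ℝ≥0∞) :
    expect (tapeLaw w hw) m G =
      ∫⁻ ω, onHalt (fun a c _ => G a c) (m (tapeOf w ω)) ∂randomness w hw :=
  lintegral_tapeLaw (hm.measurable_const G)

lemma Fresh.prob_tapeLaw_le {m : Prog U α} (hm : Fresh (tapeLaw w hw) m) (s : Set α) :
    prob (tapeLaw w hw) m s ≤ randomness w hw {ω | ∃ r, m (tapeOf w ω) = some r ∧ r.1 ∈ s} := by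
  refine (hm.expect_tapeLaw _).trans_le
    ((lintegral_mono fun ω => ?_).trans (lintegral_indicator_one_le _))
  rcases h : m (tapeOf w ω) with _ | r
  · exact zero_le
  · by_cases hr : r.1 ∈ s
    · have hω : ω ∈ {ω | ∃ r, m (tapeOf w ω) = some r ∧ r.1 ∈ s} := ⟨r, h, hr⟩
      rw [onHalt_some, Set.indicator_of_mem hr, Set.indicator_of_mem hω]
      rfl
    · rw [onHalt_some, Set.indicator_of_notMem hr]
      exact zero_le

lemma Proper.ae_isSome {m : Prog U α} (hm : Proper (tapeLaw w hw) m) :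
    ∀ᵐ ω ∂randomness w hw, (m (tapeOf w ω)).isSome := by
  let halts (ω : (ℕ → U) × (ℕ → unitInterval)) : ℝ≥0∞ := onHalt (fun _ _ _ => 1) (m (tapeOf w ω))
  have hle : halts ≤ fun _ => 1 := fun ω => by
    simp only [halts]
    rcases m (tapeOf w ω) with _ | _ <;> simp
  have hone : ∫⁻ _, 1 ∂randomness w hw ≤ ∫⁻ ω, halts ω ∂randomness w hw := by
    rw [← hm.expect_tapeLaw fun _ _ => 1, lintegral_one, measure_univ]
    exact hm.mean_one.ge
  have hfin : ∫⁻ ω, halts ω ∂randomness w hw ≠ ∞ :=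
    ne_top_of_le_ne_top ENNReal.one_ne_top ((hm.expect_tapeLaw _).symm.trans hm.mean_one).le
  filter_upwards [ae_eq_of_ae_le_of_lintegral_le (ae_of_all _ hle) hfin
    aemeasurable_const hone] with ω hω
  simp only [halts] at hω
  rcases h : m (tapeOf w ω) with _ | r
  · simp [h] at hω
  · rfl

lemma Proper.lintegral_sampleCount {m : Prog U α} (hm : Proper (tapeLaw w hw) m) :
    ∫⁻ ω, sampleCount m (tapeOf w ω) ∂randomness w hw = cost (tapeLaw w hw) m := by
  rw [cost, hm.expect_tapeLaw]
  refine lintegral_congr_ae ?_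
  filter_upwards [hm.ae_isSome] with ω hω
  unfold sampleCount
  obtain ⟨r, hr⟩ := Option.isSome_iff_exists.1 hω
  rw [hr]
  rfl

lemma two_thirds_le_randomness_approximates [MeasurableSingletonClass U] [DecidableEq U] {ε : ℝ}
    (hε : ε ∈ Set.Ioo 0 1) :
    2 / 3 ≤ randomness w hw
      {ω | Approximates (noAdvicePropEstimator ε) (tapeOf w ω) ε ((∑ a, w a : ℝ≥0) : ℝ)} :=
  (two_thirds_le_prob_noAdvicePropEstimator hε).trans
    ((Proper.noAdvicePropEstimator hε.1).prob_tapeLaw_le _)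

end Execution

/-! ### The cost for a given bucket -/

lemma ofNat_mul_ofReal (n : ℕ) [n.AtLeastTwo] (x : ℝ) :
    (OfNat.ofNat n : ℝ≥0∞) * ENNReal.ofReal x = ENNReal.ofReal (OfNat.ofNat n * x) := by
  rw [ENNReal.ofReal_mul (Nat.ofNat_nonneg n), ENNReal.ofReal_ofNat]

section BucketCost

variable [Fintype U] [MeasurableSpace U] [MeasurableSingletonClass U]
  {w : U → ℝ≥0} {hw : 0 < ∑ a, w a} {b : ℤ} {ε : ℝ}

lemma cost_amplify_bernoulliEstimator_le (hb : (bucket w b).Nonempty) (hε : 0 < ε) :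
    cost (tapeLaw w hw) (amplify (bernoulliEstimator (bucketTrial b) (ε / 3))) ≤
      ENNReal.ofReal (1620 / ε ^ 2 + 15) / bucketProb w b := by
  have hδ : 0 < ε / 3 := by positivity
  have hpos : (0 : ℝ) < bucketProb w b := by exact_mod_cast bucketProb_pos hb
  calc _ ≤ 15 * (1 * ENNReal.ofReal ((⌈12 / (ε / 3) ^ 2⌉₊ : ℝ) / bucketProb w b)) := by
        refine ((proper_bucketTrial b).toFresh.bernoulliEstimator (ε / 3)).cost_amplify_le.trans ?_
        gcongr
        refine (cost_bernoulliEstimator_le (trialWith_bucketTrial hb) hδ).trans ?_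
        gcongr
        exact cost_bucketTrial_le b
    _ = ENNReal.ofReal (15 * ⌈12 / (ε / 3) ^ 2⌉₊) / bucketProb w b := by
        rw [one_mul, ENNReal.ofReal_div_of_pos hpos, ENNReal.ofReal_coe_nnreal, ← mul_div_assoc,
          ofNat_mul_ofReal]
    _ ≤ ENNReal.ofReal (15 * (12 / (ε / 3) ^ 2 + 1)) / bucketProb w b := by
        gcongr
        exact (Nat.ceil_lt_add_one (by positivity)).le
    _ = _ := by
        ring_nf

variable [DecidableEq U]

lemma cost_amplify_setSizeEstimator_le (hb : (bucket w b).Nonempty) :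
    cost (tapeLaw w hw) (amplify (setSizeEstimator (unifBucketSampler b))) ≤
      ENNReal.ofReal (90 * √(bucket w b).card) / bucketProb w b :=
  calc _ ≤ 15 * (2 / bucketProb w b * ENNReal.ofReal (3 * √(bucket w b).card)) := by
        refine (fresh_unifBucketSampler b).setSizeEstimator.cost_amplify_le.trans ?_
        gcongr
        refine (cost_setSizeEstimator_le (samples_unifBucketSampler hb)).trans ?_
        gcongr
        exact cost_unifBucketSampler_le hb
    _ = 15 * (2 * ENNReal.ofReal (3 * √(bucket w b).card)) / bucketProb w b := by
        simp only [div_eq_mul_inv]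
        ring
    _ = _ := by
        rw [ofNat_mul_ofReal, ofNat_mul_ofReal]
        ring_nf

lemma cost_amplify_propEstimator_le (hb : (bucket w b).Nonempty) (hε : 0 < ε) (N : ℝ) :
    cost (tapeLaw w hw) (amplify (propEstimator (propBucketSampler b) N (ε / 3))) ≤
      ENNReal.ofReal (225 / ε * √N + 30) / bucketProb w b := by
  have hfresh := fresh_propBucketSampler (hw := hw) b
  calc _ ≤ 15 * (ENNReal.ofReal (5 / (ε / 3) * √N + 2) * (1 / bucketProb w b)) := by
        refine (hfresh.propEstimator N (ε / 3)).cost_amplify_le.trans ?_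
        gcongr
        refine (hfresh.cost_propEstimator_le N (by positivity)).trans ?_
        gcongr
        exact cost_propBucketSampler_le hb
    _ = _ := by
        rw [mul_one_div, ← mul_div_assoc, ofNat_mul_ofReal]
        ring_nf

lemma mean_sqrt_amplify_setSizeEstimator_le (hb : (bucket w b).Nonempty) :
    mean (tapeLaw w hw) (amplify (setSizeEstimator (unifBucketSampler b)))
      (fun n => ENNReal.ofReal √(n : ℝ)) ≤ ENNReal.ofReal (90 * √(bucket w b).card) := by
  refine ((fresh_unifBucketSampler b).setSizeEstimator.mean_amplify_le _).trans ?_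
  calc _ ≤ 15 * ENNReal.ofReal (6 * √(bucket w b).card) := by
        gcongr
        exact mean_sqrt_setSizeEstimator_le (samples_unifBucketSampler hb)
    _ = _ := by
        rw [ofNat_mul_ofReal]
        ring_nf

lemma cost_bucketEstimator_le_mean (hb : (bucket w b).Nonempty) (hε : 0 < ε) :
    cost (tapeLaw w hw) (bucketEstimator ε b) ≤
      ENNReal.ofReal (90 * √(bucket w b).card) / bucketProb w b +
        mean (tapeLaw w hw) (amplify (setSizeEstimator (unifBucketSampler b))) fun n =>
          ENNReal.ofReal (225 / ε * √(n : ℝ) + 30) / bucketProb w b +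
            ENNReal.ofReal (1620 / ε ^ 2 + 15) / bucketProb w b := by
  have hfWeight (n : ℕ) := ((fresh_propBucketSampler (hw := hw) b).propEstimator n (ε / 3)).amplify
  have hfProb := ((proper_bucketTrial (hw := hw) b).toFresh.bernoulliEstimator (ε / 3)).amplify
  refine ((fresh_unifBucketSampler b).setSizeEstimator.amplify.cost_bind_le fun n =>
    (hfWeight n).bind fun _ => hfProb.bind fun _ => Fresh.pure _).trans
    (add_le_add (cost_amplify_setSizeEstimator_le hb) (mean_mono fun n => ?_))
  refine ((hfWeight n).cost_bind_le fun _ => hfProb.bind fun _ => Fresh.pure _).trans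
    (add_le_add (cost_amplify_propEstimator_le hb hε n) ?_)
  exact (mean_mono fun _ => (hfProb.cost_bind_pure_le _).trans
    (cost_amplify_bernoulliEstimator_le hb hε)).trans ((hfWeight n).mean_const_le _)

lemma cost_bucketEstimator_le (hb : (bucket w b).Nonempty) (hε : ε ∈ Set.Ioo 0 1) :
    cost (tapeLaw w hw) (bucketEstimator ε b) ≤
      ENNReal.ofReal (21000 * √(bucket w b).card / ε + 1700 / ε ^ 2) / bucketProb w b := by
  obtain ⟨hε0, hε1⟩ := hε
  have hfresh := (fresh_unifBucketSampler (hw := hw) b).setSizeEstimator.amplify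
  have hlin (n : ℕ) : ENNReal.ofReal (225 / ε * √(n : ℝ) + 30) / bucketProb w b +
      ENNReal.ofReal (1620 / ε ^ 2 + 15) / bucketProb w b =
      ENNReal.ofReal √(n : ℝ) * (ENNReal.ofReal (225 / ε) / bucketProb w b) +
        ENNReal.ofReal (1620 / ε ^ 2 + 45) / bucketProb w b := by
    rw [← ENNReal.add_div, ← ENNReal.ofReal_add (by positivity) (by positivity), ← mul_div_assoc,
      ← ENNReal.add_div, ← ENNReal.ofReal_mul (by positivity),
      ← ENNReal.ofReal_add (by positivity) (by positivity)]
    ring_nf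
  have hε_inv_sq : 1 ≤ 1 / ε ^ 2 := (one_le_div (by positivity)).2 (pow_le_one₀ hε0.le hε1.le)
  calc cost (tapeLaw w hw) (bucketEstimator ε b)
      ≤ ENNReal.ofReal (90 * √(bucket w b).card) / bucketProb w b +
          (ENNReal.ofReal (90 * √(bucket w b).card) *
            (ENNReal.ofReal (225 / ε) / bucketProb w b) +
            ENNReal.ofReal (1620 / ε ^ 2 + 45) / bucketProb w b) := by
        refine (cost_bucketEstimator_le_mean hb hε0).trans ?_
        simp only [hlin]
        rw [hfresh.mean_add, hfresh.mean_mul_const]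
        gcongr
        · exact mean_sqrt_amplify_setSizeEstimator_le hb
        · exact hfresh.mean_const_le _
    _ = ENNReal.ofReal (90 * √(bucket w b).card + (90 * √(bucket w b).card * (225 / ε) +
          (1620 / ε ^ 2 + 45))) / bucketProb w b := by
        rw [← mul_div_assoc, ← ENNReal.add_div, ← ENNReal.add_div,
          ← ENNReal.ofReal_mul (by positivity), ← ENNReal.ofReal_add (by positivity)
          (by positivity), ← ENNReal.ofReal_add (by positivity) (by positivity)]
    _ ≤ _ := by
        refine ENNReal.div_le_div_right (ENNReal.ofReal_le_ofReal ?_) _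
        have hsqrt : √(bucket w b).card ≤ √(bucket w b).card / ε :=
          le_div_self (Real.sqrt_nonneg _) hε0 hε1.le
        calc _ = 90 * √(bucket w b).card + 20250 * (√(bucket w b).card / ε) +
              1620 * (1 / ε ^ 2) + 45 := by ring
          _ ≤ 21000 * (√(bucket w b).card / ε) + 1700 * (1 / ε ^ 2) := by
            linarith [Real.sqrt_nonneg (bucket w b).card]
          _ = _ := by ring

end BucketCost

/-! ### Averaging over the choice of the bucket -/

section Levels

variable [Fintype U]

/-- The levels of the items of positive weight, which index the nonempty buckets. -/
def levels (w : U → ℝ≥0) : Finset ℤ :=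
  (Finset.univ.filter fun a => 0 < w a).image fun a => level (w a)

/-- The probability that a proportional sample has level at most `b`. -/
def lowProb (w : U → ℝ≥0) (b : ℤ) : ℝ≥0 :=
  (∑ a with level (w a) ≤ b, w a) / ∑ a, w a

variable {w : U → ℝ≥0}

lemma mem_levels {b : ℤ} : b ∈ levels w ↔ (bucket w b).Nonempty := by
  simp only [levels, Finset.mem_image, Finset.mem_filter_univ, Finset.Nonempty,
    mem_bucket_iff_level]

variable (hw : 0 < ∑ a, w a)

lemma sum_propPMF_lowProb (b : ℤ) :
    ∑ a with level (w a) ≤ b, propPMF w hw a = lowProb w b := by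
  simp only [propPMF_apply, ← ENNReal.ofNNReal_finsetSum, ← Finset.sum_div]
  rfl

lemma sum_propPMF_mul_level (F : ℤ → ℝ≥0∞) :
    ∑ a, propPMF w hw a * F (level (w a)) = ∑ b ∈ levels w, bucketProb w b * F b := by
  have hfiber (b : ℤ) :
      (Finset.univ.filter fun a => 0 < w a).filter (fun a => level (w a) = b) = bucket w b := by
    ext a
    simp only [Finset.mem_filter, Finset.mem_univ, true_and, mem_bucket_iff_level]
  calc ∑ a, propPMF w hw a * F (level (w a))
      = ∑ a with 0 < w a, propPMF w hw a * F (level (w a)) := by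
        refine (Finset.sum_filter_of_ne fun a _ ha => pos_iff_ne_zero.2 fun h => ha ?_).symm
        simp [propPMF_apply, h]
    _ = ∑ b ∈ levels w, ∑ a ∈ bucket w b, propPMF w hw a * F (level (w a)) := by
        rw [← Finset.sum_fiberwise_of_maps_to (t := levels w) (g := fun a => level (w a))
          fun a ha => Finset.mem_image_of_mem _ ha]
        simp only [hfiber]
    _ = ∑ b ∈ levels w, bucketProb w b * F b := by
        refine Finset.sum_congr rfl fun b _ => ?_
        rw [← sum_propPMF_bucket hw b, Finset.sum_mul]
        exact Finset.sum_congr rfl fun a ha => by rw [(mem_bucket_iff_level.1 ha).2]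

variable [MeasurableSpace U] [MeasurableSingletonClass U]

/-- By symmetry it is enough to consider the event that the first sample has the larger level. -/
lemma mean_draw_max_level_le (R : ℤ → ℝ≥0∞) :
    (mean (tapeLaw w hw) draw fun x => mean (tapeLaw w hw) draw fun y =>
      R (max (level x.2) (level y.2))) ≤
        2 * ∑ b ∈ levels w, bucketProb w b * (R b * lowProb w b) := by
  let first (a a' : U) : ℝ≥0∞ := propPMF w hw a * (propPMF w hw a' *
    if level (w a') ≤ level (w a) then R (level (w a)) else 0)
  have hfirst :
      ∑ a, ∑ a', first a a' = ∑ b ∈ levels w, bucketProb w b * (R b * lowProb w b) := by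
    rw [← sum_propPMF_mul_level hw fun b => R b * lowProb w b]
    refine Finset.sum_congr rfl fun a _ => ?_
    simp only [first, mul_ite, mul_zero, ← sum_propPMF_lowProb hw, ← Finset.sum_filter,
      ← Finset.mul_sum, ← Finset.sum_mul]
    rw [mul_comm (R _)]
  calc _ = ∑ a, ∑ a', propPMF w hw a * (propPMF w hw a' *
          R (max (level (w a)) (level (w a')))) := by
        simp only [mean_draw, Finset.mul_sum]
    _ ≤ ∑ a, ∑ a', (first a a' + first a' a) := by
        refine Finset.sum_le_sum fun a _ => Finset.sum_le_sum fun a' _ => ?_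
        rcases le_total (level (w a')) (level (w a)) with h | h
        · refine le_add_right (le_of_eq ?_)
          simp only [first, if_pos h, max_eq_left h]
        · refine le_add_left (le_of_eq ?_)
          simp only [first, if_pos h, max_eq_right h]
          ring
    _ = 2 * ∑ b ∈ levels w, bucketProb w b * (R b * lowProb w b) := by
        simp only [Finset.sum_add_distrib]
        rw [Finset.sum_comm (f := fun a a' => first a' a), hfirst, two_mul]

variable {hw} [DecidableEq U]

lemma cost_noAdvicePropEstimator_le_sum {ε : ℝ} (hε : ε ∈ Set.Ioo 0 1) :
    cost (tapeLaw w hw) (noAdvicePropEstimator ε) ≤ 2 + 2 * ∑ b ∈ levels w,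
      ENNReal.ofReal (21000 * √(bucket w b).card / ε + 1700 / ε ^ 2) * lowProb w b := by
  let R (b : ℤ) : ℝ≥0∞ :=
    ENNReal.ofReal (21000 * √(bucket w b).card / ε + 1700 / ε ^ 2) / bucketProb w b
  have hdraw := Proper.draw (hw := hw)
  have hsecond (x : U × ℝ) :
      cost (tapeLaw w hw) (draw >>= fun y => bucketEstimator ε (max (level x.2) (level y.2))) ≤
        1 + mean (tapeLaw w hw) draw fun y =>
          cost (tapeLaw w hw) (bucketEstimator ε (max (level x.2) (level y.2))) :=
    (hdraw.toFresh.cost_bind_le fun _ => Fresh.bucketEstimator _ _).trans_eq (by rw [cost_draw])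
  calc cost (tapeLaw w hw) (noAdvicePropEstimator ε)
      ≤ 1 + (1 + mean (tapeLaw w hw) draw fun x => mean (tapeLaw w hw) draw fun y =>
          cost (tapeLaw w hw) (bucketEstimator ε (max (level x.2) (level y.2)))) := by
        rw [noAdvicePropEstimator_eq]
        refine (hdraw.toFresh.cost_bind_le fun _ => hdraw.toFresh.bind fun _ =>
          Fresh.bucketEstimator _ _).trans ?_
        rw [cost_draw]
        gcongr
        refine (mean_mono hsecond).trans_eq ?_
        rw [hdraw.mean_add, hdraw.mean_const]
    _ ≤ 1 + (1 + mean (tapeLaw w hw) draw fun x => mean (tapeLaw w hw) draw fun y =>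
          R (max (level x.2) (level y.2))) := by
        gcongr
        exact mean_draw_mono fun a ha => mean_draw_mono fun a' ha' =>
          cost_bucketEstimator_le (bucket_max_level_nonempty ha ha') hε
    _ ≤ 1 + (1 + 2 * ∑ b ∈ levels w, bucketProb w b * (R b * lowProb w b)) := by
        gcongr
        exact mean_draw_max_level_le hw R
    _ = _ := by
        rw [← add_assoc, one_add_one_eq_two]
        congr 2
        refine Finset.sum_congr rfl fun b hb => ?_
        have hpos : (bucketProb w b : ℝ≥0∞) ≠ 0 := by
          exact_mod_cast (bucketProb_pos (mem_levels.1 hb)).ne'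
        rw [← mul_assoc, ENNReal.mul_div_cancel hpos ENNReal.coe_ne_top]

end Levels

/-! ### Levels above and below the mean weight -/

lemma sum_pow_le_of_injOn {ι : Type} {s : Finset ι} {e : ι → ℕ} (he : Set.InjOn e s) {r : ℝ}
    (h0 : 0 ≤ r) (h1 : r < 1) : ∑ i ∈ s, r ^ e i ≤ (1 - r)⁻¹ := by
  rw [← tsum_geometric_of_lt_one h0 h1, ← Finset.sum_image (f := fun k => r ^ k) he]
  exact (summable_geometric_of_lt_one h0 h1).sum_le_tsum _ fun _ _ => by positivity

section MeanLevel

variable [Fintype U] {w : U → ℝ≥0} {b : ℤ}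

lemma lowProb_le_one (w : U → ℝ≥0) (b : ℤ) : lowProb w b ≤ 1 :=
  div_le_one_of_le₀ (Finset.sum_le_univ_sum_of_nonneg fun _ => zero_le) zero_le

lemma lowProb_le (w : U → ℝ≥0) (b : ℤ) :
    (lowProb w b : ℝ) ≤ Fintype.card U * (2 : ℝ) ^ (b + 1) / (∑ a, w a : ℝ≥0) := by
  rw [lowProb, NNReal.coe_div, NNReal.coe_sum]
  gcongr
  calc ∑ a with level (w a) ≤ b, (w a : ℝ)
      ≤ ∑ a with level (w a) ≤ b, (2 : ℝ) ^ (b + 1) := by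
        refine Finset.sum_le_sum fun a ha => ?_
        rcases eq_zero_or_pos (w a) with h0 | h0
        · rw [h0, NNReal.coe_zero]
          positivity
        · refine (mem_Ico_zpow_level (by exact_mod_cast h0)).2.le.trans ?_
          gcongr
          exacts [one_le_two, (Finset.mem_filter.1 ha).2]
    _ ≤ _ := by
        rw [Finset.sum_const, nsmul_eq_mul]
        gcongr
        exact Finset.card_le_univ _

lemma card_bucket_mul_le (w : U → ℝ≥0) (b : ℤ) :
    (bucket w b).card * (2 : ℝ) ^ b ≤ (∑ a, w a : ℝ≥0) := by
  rw [← nsmul_eq_mul, ← Finset.sum_const]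
  calc ∑ _a ∈ bucket w b, (2 : ℝ) ^ b ≤ ∑ a ∈ bucket w b, (w a : ℝ) :=
        Finset.sum_le_sum fun _ ha => (mem_bucket.1 ha).1
    _ = bucketWeight w b := (NNReal.coe_sum _ _).symm
    _ ≤ _ := by exact_mod_cast bucketWeight_le_sum w b

lemma zpow_le_sum_of_mem_levels (hb : b ∈ levels w) : (2 : ℝ) ^ b ≤ (∑ a, w a : ℝ≥0) := by
  refine le_trans ?_ (card_bucket_mul_le w b)
  exact le_mul_of_one_le_left (by positivity) (by exact_mod_cast (mem_levels.1 hb).card_pos)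

/-- The level of the mean weight. -/
def meanLevel (w : U → ℝ≥0) : ℤ := level ((∑ a, w a : ℝ≥0) / Fintype.card U)

lemma sum_mem_Ico_meanLevel (hw : 0 < ∑ a, w a) :
    ((∑ a, w a : ℝ≥0) : ℝ) ∈ Set.Ico (Fintype.card U * (2 : ℝ) ^ meanLevel w)
      (Fintype.card U * (2 : ℝ) ^ (meanLevel w + 1)) := by
  have hcard : (0 : ℝ) < Fintype.card U := by
    obtain ⟨a, -, -⟩ := Finset.exists_ne_zero_of_sum_ne_zero hw.ne'
    exact_mod_cast Fintype.card_pos_iff.2 ⟨a⟩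
  have hmean : 0 < ((∑ a, w a : ℝ≥0) : ℝ) / Fintype.card U :=
    div_pos (by exact_mod_cast hw) hcard
  have h := mem_Ico_zpow_level hmean
  rwa [Set.mem_Ico, le_div_iff₀' hcard, div_lt_iff₀' hcard] at h

lemma lowProb_le_of_le_meanLevel (hw : 0 < ∑ a, w a) (hb : b ≤ meanLevel w) :
    (lowProb w b : ℝ) ≤ 2 * (1 / 2) ^ (meanLevel w - b).toNat := by
  obtain ⟨j, hj⟩ := Int.le.dest hb
  have hW : (0 : ℝ) < (∑ a, w a : ℝ≥0) := by exact_mod_cast hw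
  rw [← hj, add_sub_cancel_left, Int.toNat_natCast]
  refine (lowProb_le w b).trans ((div_le_iff₀ hW).2 ?_)
  calc Fintype.card U * (2 : ℝ) ^ (b + 1)
      = 2 * (1 / 2) ^ j * (Fintype.card U * (2 : ℝ) ^ meanLevel w) := by
        rw [← hj, zpow_add₀ two_ne_zero, zpow_add₀ two_ne_zero, zpow_natCast, zpow_one, one_div,
          inv_pow]
        field_simp
    _ ≤ _ := by
        gcongr
        exact (sum_mem_Ico_meanLevel hw).1

lemma card_bucket_le_of_meanLevel_le (hw : 0 < ∑ a, w a) (hb : meanLevel w ≤ b) :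
    ((bucket w b).card : ℝ) ≤ Fintype.card U * (2 * (1 / 2) ^ (b - meanLevel w).toNat) := by
  obtain ⟨j, rfl⟩ := Int.le.dest hb
  rw [add_sub_cancel_left, Int.toNat_natCast]
  refine le_of_mul_le_mul_right (a := (2 : ℝ) ^ (meanLevel w + j)) ?_ (by positivity)
  calc _ ≤ Fintype.card U * (2 : ℝ) ^ (meanLevel w + 1) :=
        (card_bucket_mul_le w _).trans (sum_mem_Ico_meanLevel hw).2.le
    _ = _ := by
        rw [zpow_add₀ two_ne_zero, zpow_add₀ two_ne_zero, zpow_natCast, zpow_one, one_div, inv_pow]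
        field_simp

lemma sqrt_two_mul_half_pow_le (j : ℕ) : √(2 * (1 / 2) ^ j) ≤ 2 * (3 / 4) ^ j := by
  refine Real.sqrt_le_iff.2 ⟨by positivity, ?_⟩
  calc (2 * (1 / 2) ^ j : ℝ) ≤ 4 * ((3 / 4) ^ 2) ^ j := by gcongr <;> norm_num
    _ = (2 * (3 / 4) ^ j) ^ 2 := by rw [← pow_mul, mul_comm 2 j, pow_mul, mul_pow]; norm_num

lemma sqrt_card_bucket_le_of_meanLevel_le (hw : 0 < ∑ a, w a) (hb : meanLevel w ≤ b) :
    √(bucket w b).card ≤ √(Fintype.card U) * (2 * (3 / 4) ^ (b - meanLevel w).toNat) := by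
  refine (Real.sqrt_le_sqrt (card_bucket_le_of_meanLevel_le hw hb)).trans ?_
  rw [Real.sqrt_mul (Nat.cast_nonneg _)]
  gcongr
  exact sqrt_two_mul_half_pow_le _

lemma sum_lowProb_lt_meanLevel_le (hw : 0 < ∑ a, w a) :
    ∑ b ∈ levels w with b < meanLevel w, (lowProb w b : ℝ) ≤ 4 := by
  have hinj : Set.InjOn (fun b => (meanLevel w - b).toNat)
      ((levels w).filter fun b => b < meanLevel w) := by
    intro x hx y hy hxy
    simp only [Finset.coe_filter, Set.mem_ofPred_eq] at hx hy hxy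
    omega
  calc ∑ b ∈ levels w with b < meanLevel w, (lowProb w b : ℝ)
      ≤ ∑ b ∈ levels w with b < meanLevel w, 2 * (1 / 2) ^ (meanLevel w - b).toNat :=
        Finset.sum_le_sum fun b hb =>
          lowProb_le_of_le_meanLevel hw (Finset.mem_filter.1 hb).2.le
    _ ≤ 2 * (1 - 1 / 2)⁻¹ := by
        rw [← Finset.mul_sum]
        gcongr
        exact sum_pow_le_of_injOn hinj (by norm_num) (by norm_num)
    _ = 4 := by norm_num

lemma sum_sqrt_card_bucket_not_lt_meanLevel_le (hw : 0 < ∑ a, w a) :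
    ∑ b ∈ levels w with ¬ b < meanLevel w, √(bucket w b).card ≤ √(Fintype.card U) * 8 := by
  have hinj : Set.InjOn (fun b => (b - meanLevel w).toNat)
      ((levels w).filter fun b => ¬ b < meanLevel w) := by
    intro x hx y hy hxy
    simp only [Finset.coe_filter, Set.mem_ofPred_eq] at hx hy hxy
    omega
  calc ∑ b ∈ levels w with ¬ b < meanLevel w, √(bucket w b).card
      ≤ ∑ b ∈ levels w with ¬ b < meanLevel w,
          √(Fintype.card U) * (2 * (3 / 4) ^ (b - meanLevel w).toNat) :=
        Finset.sum_le_sum fun b hb =>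
          sqrt_card_bucket_le_of_meanLevel_le hw (not_lt.1 (Finset.mem_filter.1 hb).2)
    _ ≤ √(Fintype.card U) * (2 * (1 - 3 / 4)⁻¹) := by
        rw [← Finset.mul_sum, ← Finset.mul_sum]
        gcongr
        exact sum_pow_le_of_injOn hinj (by norm_num) (by norm_num)
    _ = _ := by norm_num

lemma sum_sqrt_mul_lowProb_le (hw : 0 < ∑ a, w a) :
    ∑ b ∈ levels w, √(bucket w b).card * lowProb w b ≤ 12 * √(Fintype.card U) := by
  have hlow : ∑ b ∈ levels w with b < meanLevel w, √(bucket w b).card * lowProb w b ≤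
      √(Fintype.card U) * 4 :=
    calc _ ≤ ∑ b ∈ levels w with b < meanLevel w, √(Fintype.card U) * lowProb w b := by
          gcongr
          exact Finset.card_le_univ _
      _ ≤ _ := by
          rw [← Finset.mul_sum]
          gcongr
          exact sum_lowProb_lt_meanLevel_le hw
  have hhigh : ∑ b ∈ levels w with ¬ b < meanLevel w, √(bucket w b).card * lowProb w b ≤
      √(Fintype.card U) * 8 :=
    (Finset.sum_le_sum fun b _ => mul_le_of_le_one_right (Real.sqrt_nonneg _)
      (by exact_mod_cast lowProb_le_one w b)).trans (sum_sqrt_card_bucket_not_lt_meanLevel_le hw)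
  rw [← Finset.sum_filter_add_sum_filter_not (levels w) fun b => b < meanLevel w]
  linarith

lemma mem_levels_le_meanLevel_add (hw : 0 < ∑ a, w a) (hb : b ∈ levels w) :
    b ≤ meanLevel w + Nat.log 2 (Fintype.card U) + 1 := by
  have hcard : (Fintype.card U : ℝ) < 2 ^ (Nat.log 2 (Fintype.card U) + 1) := by
    exact_mod_cast Nat.lt_pow_succ_log_self one_lt_two _
  have hlt : (2 : ℝ) ^ b < 2 ^ (((Nat.log 2 (Fintype.card U) + 1 : ℕ) : ℤ) + (meanLevel w + 1)) :=
    calc (2 : ℝ) ^ b ≤ (∑ a, w a : ℝ≥0) := zpow_le_sum_of_mem_levels hb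
      _ < Fintype.card U * 2 ^ (meanLevel w + 1) := (sum_mem_Ico_meanLevel hw).2
      _ ≤ 2 ^ (Nat.log 2 (Fintype.card U) + 1) * 2 ^ (meanLevel w + 1) := by gcongr
      _ = _ := by rw [zpow_add₀ two_ne_zero (_ : ℤ) (_ + 1), zpow_natCast]
  have := (zpow_lt_zpow_iff_right₀ one_lt_two).1 hlt
  push_cast at this
  omega

lemma card_levels_not_lt_meanLevel_le (hw : 0 < ∑ a, w a) :
    ((levels w).filter fun b => ¬ b < meanLevel w).card ≤ Nat.log 2 (Fintype.card U) + 2 := by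
  have hsub : (levels w).filter (fun b => ¬ b < meanLevel w) ⊆
      Finset.Icc (meanLevel w) (meanLevel w + Nat.log 2 (Fintype.card U) + 1) := fun b hb =>
    Finset.mem_Icc.2 ⟨not_lt.1 (Finset.mem_filter.1 hb).2,
      mem_levels_le_meanLevel_add hw (Finset.mem_filter.1 hb).1⟩
  refine (Finset.card_le_card hsub).trans ?_
  rw [Int.card_Icc]
  omega

lemma sum_lowProb_le (hw : 0 < ∑ a, w a) :
    ∑ b ∈ levels w, (lowProb w b : ℝ) ≤ Nat.log 2 (Fintype.card U) + 6 := by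
  have hhigh : ∑ b ∈ levels w with ¬ b < meanLevel w, (lowProb w b : ℝ) ≤
      Nat.log 2 (Fintype.card U) + 2 :=
    calc _ ≤ ∑ b ∈ levels w with ¬ b < meanLevel w, (1 : ℝ) :=
          Finset.sum_le_sum fun b _ => by exact_mod_cast lowProb_le_one w b
      _ ≤ _ := by
          rw [Finset.sum_const, nsmul_one]
          exact_mod_cast card_levels_not_lt_meanLevel_le hw
  rw [← Finset.sum_filter_add_sum_filter_not (levels w) fun b => b < meanLevel w]
  linarith [sum_lowProb_lt_meanLevel_le hw]

lemma natLog_two_add_six_le {n : ℕ} (hn : 2 ≤ n) :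
    (Nat.log 2 n + 6 : ℝ) ≤ 12 * Real.log n := by
  have hlog2 : 0 < Real.log 2 := Real.log_pos one_lt_two
  have hle : Real.log 2 ≤ Real.log n := Real.log_le_log two_pos (by exact_mod_cast hn)
  have hnat : (Nat.log 2 n : ℝ) * Real.log 2 ≤ Real.log n :=
    (le_div_iff₀ hlog2).1 (by exact_mod_cast Real.natLog_le_logb n 2)
  nlinarith [Real.log_two_gt_d9, (Nat.log 2 n).cast_nonneg (α := ℝ)]

lemma sum_cost_mul_lowProb_le (hw : 0 < ∑ a, w a) (hn : 2 ≤ Fintype.card U) {ε : ℝ} (hε : 0 < ε) :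
    ∑ b ∈ levels w, (21000 * √(bucket w b).card / ε + 1700 / ε ^ 2) * lowProb w b ≤
      252000 * (√(Fintype.card U) / ε) + 20400 * (Real.log (Fintype.card U) / ε ^ 2) :=
  calc _ = 21000 / ε * ∑ b ∈ levels w, √(bucket w b).card * lowProb w b +
        1700 / ε ^ 2 * ∑ b ∈ levels w, (lowProb w b : ℝ) := by
        rw [Finset.mul_sum, Finset.mul_sum, ← Finset.sum_add_distrib]
        exact Finset.sum_congr rfl fun b _ => by ring
    _ ≤ 21000 / ε * (12 * √(Fintype.card U)) +
        1700 / ε ^ 2 * (12 * Real.log (Fintype.card U)) := by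
        gcongr
        · exact sum_sqrt_mul_lowProb_le hw
        · exact (sum_lowProb_le hw).trans (natLog_two_add_six_le hn)
    _ = _ := by ring

variable [DecidableEq U] [MeasurableSpace U] [MeasurableSingletonClass U] {hw : 0 < ∑ a, w a}

lemma cost_noAdvicePropEstimator_le (hn : 2 ≤ Fintype.card U) {ε : ℝ} (hε : ε ∈ Set.Ioo 0 1) :
    cost (tapeLaw w hw) (noAdvicePropEstimator ε) ≤
      ENNReal.ofReal (600000 * (√(Fintype.card U) / ε + Real.log (Fintype.card U) / ε ^ 2)) := by
  obtain ⟨hε0, hε1⟩ := hε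
  have hsqrt : 1 ≤ √(Fintype.card U) / ε :=
    (one_le_div hε0).2 (hε1.le.trans (Real.one_le_sqrt.2 (by exact_mod_cast one_le_two.trans hn)))
  have hlog : 0 ≤ Real.log (Fintype.card U) / ε ^ 2 :=
    div_nonneg (Real.log_natCast_nonneg _) (by positivity)
  calc cost (tapeLaw w hw) (noAdvicePropEstimator ε)
      ≤ 2 + 2 * ∑ b ∈ levels w,
          ENNReal.ofReal (21000 * √(bucket w b).card / ε + 1700 / ε ^ 2) * lowProb w b :=
        cost_noAdvicePropEstimator_le_sum ⟨hε0, hε1⟩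
    _ = ENNReal.ofReal (2 + 2 * ∑ b ∈ levels w,
          (21000 * √(bucket w b).card / ε + 1700 / ε ^ 2) * lowProb w b) := by
        rw [ENNReal.ofReal_add (by positivity) (by positivity), ← ofNat_mul_ofReal,
          ENNReal.ofReal_ofNat, ENNReal.ofReal_sum_of_nonneg fun _ _ => by positivity]
        congr! 4 with b
        rw [ENNReal.ofReal_mul (by positivity), ENNReal.ofReal_coe_nnreal]
    _ ≤ _ := by
        refine ENNReal.ofReal_le_ofReal ?_
        linarith [sum_cost_mul_lowProb_le hw hn hε0]

lemma lintegral_sampleCount_noAdvicePropEstimator_le (hn : 2 ≤ Fintype.card U) {ε : ℝ}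
    (hε : ε ∈ Set.Ioo 0 1) :
    ∫⁻ ω, sampleCount (noAdvicePropEstimator ε) (tapeOf w ω) ∂randomness w hw ≤
      ENNReal.ofReal (600000 * (√(Fintype.card U) / ε + Real.log (Fintype.card U) / ε ^ 2)) :=
  (Proper.noAdvicePropEstimator hε.1).lintegral_sampleCount.trans_le
    (cost_noAdvicePropEstimator_le hn hε)

end MeanLevel

end PropSampling

end

theorem mainTheorem2 :
    ∃ C : ℝ, 0 < C ∧
      ∀ (U : Type) [Fintype U] [DecidableEq U] [MeasurableSpace U] [MeasurableSingletonClass U]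
        (w : U → ℝ≥0) (hw : 0 < ∑ a, w a) (ε : ℝ), 0 < ε → ε < 1 →
        (2 / 3 : ℝ≥0∞) ≤ PropSampling.randomness w hw
            {ω | PropSampling.Approximates (PropSampling.noAdvicePropEstimator ε)
              (PropSampling.tapeOf w ω) ε ((∑ a, w a : ℝ≥0) : ℝ)} ∧
        (2 ≤ Fintype.card U →
          ∫⁻ ω, PropSampling.sampleCount (PropSampling.noAdvicePropEstimator ε)
              (PropSampling.tapeOf w ω) ∂(PropSampling.randomness w hw) ≤
            ENNReal.ofReal (C * (√(Fintype.card U : ℝ) / ε +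
              Real.log (Fintype.card U : ℝ) / ε ^ 2))) := by
  refine ⟨600000, by norm_num, fun U _ _ _ _ w hw ε h0 h1 => ⟨?_, fun hn => ?_⟩⟩
  · exact PropSampling.two_thirds_le_randomness_approximates ⟨h0, h1⟩
  · exact PropSampling.lintegral_sampleCount_noAdvicePropEstimator_le hn ⟨h0, h1⟩
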